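/- **Setting.** Let $G$ be a finite group, $d$ a natural number, $\mathcal M_d$ the space of complex $d\times d$ matrices and $\mathcal S_d$ the space of linear maps $\mathcal M_d\to\mathcal M_d$ (super-operators), with diamond norm $\|\Phi\|_\diamond=\max_{\|X\|_1\le 1}\|(\Phi\otimes \mathrm{id}_d)(X)\|_1$. A quantum channel is a completely positive trace-preserving element of $\mathcal S_d$. Let $\omega:G\to\mathcal S_d$ be a representation of $G$ by quantum channels (the reference representation), with decomposition $\omega\simeq\bigoplus_{\lambda\in\Lambda}\sigma_\lambda^{\oplus n_\lambda}$ into pairwise inequivalent irreducible unitary matrix representations $\sigma_\lambda$ with multiplicities $n_\lambda$. Let $\phi:G\to\mathcal S_d$ be an implementation map, each $\phi(g)$ being completely positive and trace non-increasing, and let $\nu$ be a probability distribution on $G$. Given an initial state $\rho_0$, a POVM $\{\Pi_i\}_{i\in I}$, quantum channels $\mathcal E_{\mathrm{SP}},\mathcal E_{\mathrm M}$ (noise of state preparation and of measurement) and an ending gate $g_{\mathrm{end}}\in G$, the output probability of the randomized benchmarking experiment with sequence length $m$ is $$p_\nu(i,m)=\sum_{g_1,\dots,g_m\in G}\nu(g_1)\cdots\nu(g_m)\,\mathrm{tr}\Big(\Pi_i\,\mathcal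 E_{\mathrm M}\big(\phi(g_{\mathrm{end}}(g_m\cdots g_1)^{-1})\,\phi(g_m)\cdots\phi(g_1)\,\mathcal E_{\mathrm{SP}}(\rho_0)\big)\Big).$$ Write $\nu^{*m}$ for the $m$-fold convolution power of $\nu$, $(\nu*\mu)(g)=\sum_h\nu(gh^{-1})\mu(h)$; put $\phi_\nu(g)=|G|\,\nu(g)\,\phi(g)$ and $$\mathcal F(\phi_\nu)[\sigma_\lambda]=\frac1{|G|}\sum_{g\in G}\overline{\sigma_\lambda(g)}\otimes\phi_\nu(g)=\sum_{g\in G}\nu(g)\,\overline{\sigma_\lambda(g)}\otimes\phi(g).$$ A dominant invariant subspace of a linear operator is the span of all generalized eigenspaces belonging to eigenvalues of absolute value greater than some threshold. **Theorem (subset randomized benchmarking).** Assume that there are an integer $m_{\mathrm{mix}}\ge 1$ and real numbers $\delta,\delta'>0$ with $\delta+\delta'\le 1/9$ such that $$\sum_{g\in G}\Big|\nu^{*m_{\mathrm{mix}}}(g)-\frac1{|G|}\Big|\le\delta',\qquad \sum_{g\in G}\nu(g)\,\|\omega(g)-\phi(g)\|_\diamond\le\frac{\delta}{m_{\mathrm{mix}}}.$$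 Then for every $\lambda\in\Lambda$ the operator $\mathcal F(\phi_\nu)[\sigma_\lambda]$ has exactly one dominant invariant subspace of dimension $n_\lambda$. Let $M_\lambda$ be the $n_\lambda\times n_\lambda$ matrix, in any basis of this subspace, of the restriction of $\mathcal F(\phi_\nu)[\sigma_\lambda]$ to it (so that $M_\lambda$ depends only on $\phi$ and $\nu$, up to the choice of basis). Then for all $\rho_0,\{\Pi_i\},\mathcal E_{\mathrm{SP}},\mathcal E_{\mathrm M},g_{\mathrm{end}}$ and every $i$ there are complex $n_\lambda\times n_\lambda$ matrices $A_\lambda$ such that for all $m\ge m_{\mathrm{mix}}$ $$\Big|p_\nu(i,m)-\sum_{\lambda\in\Lambda}\mathrm{tr}\big(A_\lambda M_\lambda^{\,m-m_{\mathrm{mix}}}\big)\Big|\le\varepsilon ,$$ where, with $\delta''=\delta+\delta'$, the constant $\varepsilon$ does not depend on $m$ and is $$\varepsilon=2\delta''\left(\Big[1+\tfrac{2\delta''}{1-5\delta''}\Big]\Big[1+\tfrac{\delta''}{1-\delta''}\Big]+\Big[\tfrac{2\delta''}{1-5\delta''}\Big]^2\Big[\tfrac{\delta''}{1-\delta''}\Big]\Big[3+\tfrac{2\delta''}{1-5\delta''}\Big]\right)\le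 4\delta''.$$ -/

import Mathlib

namespace RB

noncomputable section

open scoped TensorProduct ComplexOrder

/-! ### Super-operators, quantum channels and the diamond norm -/

/-- `d × d` complex matrices, that is, linear operators on `ℂ^d`. -/
abbrev Op (d : ℕ) : Type := Matrix (Fin d) (Fin d) ℂ

/-- Super-operators: linear maps from `d × d` matrices to themselves. -/
abbrev SuperOp (d : ℕ) : Type := Module.End ℂ (Op d)

/-- The trace norm `‖A‖₁ = tr √(A† A)`, the sum of the singular values of `A`. -/
def traceNorm {ι : Type*} [Fintype ι] [DecidableEq ι] (A : Matrix ι ι ℂ) : ℝ :=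
  ∑ i, Real.sqrt ((Matrix.isHermitian_conjTranspose_mul_self A).eigenvalues i)

/-- `(Φ ⊗ id_k)(X)`: the super-operator `Φ` applied to the first factor of an operator on
`ℂ^d ⊗ ℂ^k`. -/
def ampliation {d : ℕ} (k : ℕ) (Φ : SuperOp d)
    (X : Matrix (Fin d × Fin k) (Fin d × Fin k) ℂ) :
    Matrix (Fin d × Fin k) (Fin d × Fin k) ℂ :=
  Matrix.of fun p q => Φ (Matrix.of fun i j => X (i, p.2) (j, q.2)) p.1 q.1

/-- The diamond norm `‖Φ‖_⋄ = ‖Φ ⊗ id_d‖_{1 → 1}`. -/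
def diamondNorm {d : ℕ} (Φ : SuperOp d) : ℝ :=
  sSup {t : ℝ | ∃ X : Matrix (Fin d × Fin d) (Fin d × Fin d) ℂ,
    traceNorm X ≤ 1 ∧ t = traceNorm (ampliation d Φ X)}

/-- Complete positivity. -/
def IsCompletelyPositive {d : ℕ} (Φ : SuperOp d) : Prop :=
  ∀ (k : ℕ) (X : Matrix (Fin d × Fin k) (Fin d × Fin k) ℂ),
    X.PosSemidef → (ampliation k Φ X).PosSemidef

/-- A super-operator that does not increase the trace of positive semidefinite operators. -/
def IsTraceNonincreasing {d : ℕ} (Φ : SuperOp d) : Prop :=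
  ∀ X : Op d, X.PosSemidef → (Φ X).trace.re ≤ X.trace.re

/-- A quantum channel: completely positive and trace preserving. -/
structure IsQuantumChannel {d : ℕ} (Φ : SuperOp d) : Prop where
  completelyPositive : IsCompletelyPositive Φ
  tracePreserving : ∀ X : Op d, (Φ X).trace = X.trace

/-- A quantum state (density matrix). -/
structure IsState {d : ℕ} (ρ : Op d) : Prop where
  posSemidef : ρ.PosSemidef
  trace_eq_one : ρ.trace = 1

/-- A positive operator valued measure with finitely many outcomes. -/
structure IsPOVM {d : ℕ} {I : Type*} [Fintype I] (E : I → Op d) : Prop where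
  posSemidef : ∀ i, (E i).PosSemidef
  sum_eq_one : ∑ i, E i = 1

section Group

variable {G : Type*} [Group G] [Fintype G]

/-! ### Probability distributions on the group -/

/-- A probability distribution on a finite group. -/
structure IsProbDist (ν : G → ℝ) : Prop where
  nonneg : ∀ g, 0 ≤ ν g
  sum_eq_one : ∑ g, ν g = 1

/-- Convolution of distributions, `(ν * μ)(g) = ∑_h ν(g h⁻¹) μ(h)`. -/
def conv (ν μ : G → ℝ) : G → ℝ := fun g => ∑ h, ν (g * h⁻¹) * μ h

open Classical in
/-- The `m`-fold convolution `ν^{*m}`; `ν^{*0}` is the point mass at the identity. -/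
def convPow (ν : G → ℝ) : ℕ → G → ℝ
  | 0 => fun g => if g = 1 then 1 else 0
  | m + 1 => conv ν (convPow ν m)

/-! ### The output probability of a randomized benchmarking experiment -/

/-- For `g = (g_1, …, g_m)`, the time-ordered product `x_{g_m} ⋯ x_{g_1}`. -/
def orderedProd {A : Type*} [Monoid A] {m : ℕ} (x : G → A) (g : Fin m → G) : A :=
  ((List.ofFn fun j => x (g j)).reverse).prod

/-- The output probability
`p_ν(i,m) = ∑_{g_1,…,g_m} ν(g_1) ⋯ ν(g_m)
  tr(Π ℰ_M (φ(g_end (g_m ⋯ g_1)⁻¹) φ(g_m) ⋯ φ(g_1) ℰ_SP(ρ₀)))`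
for the POVM element `E = Π`. -/
def outputProb {d : ℕ} (ν : G → ℝ) (φ : G → SuperOp d) (gEnd : G)
    (prep meas : SuperOp d) (ρ₀ E : Op d) (m : ℕ) : ℂ :=
  ∑ g : Fin m → G, ((∏ j, ν (g j) : ℝ) : ℂ) *
    (E * meas (φ (gEnd * (orderedProd id g)⁻¹) (orderedProd φ g (prep ρ₀)))).trace

/-! ### Representations and the matrix-valued Fourier transform -/

/-- The representation on `ℂ^k` given by unitary matrices. -/
def unitaryRep {k : ℕ} (σ : G →* Matrix.unitaryGroup (Fin k) ℂ) :
    Representation ℂ G (Fin k → ℂ) where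
  toFun g := Matrix.toLin' (σ g : Matrix (Fin k) (Fin k) ℂ)
  map_one' := by simp [Module.End.one_eq_id]
  map_mul' g h := by simp [Matrix.toLin'_mul, Module.End.mul_eq_comp]

/-- `ω ≃ ⨁_λ σ_λ^{⊕ n_λ}`, where the `σ_λ` are irreducible unitary representations that are
pairwise inequivalent. -/
structure IsIrrepDecomposition {d : ℕ} (ω : Representation ℂ G (Op d))
    {Λ : Type*} [Fintype Λ] {D : Λ → ℕ}
    (σ : ∀ l, G →* Matrix.unitaryGroup (Fin (D l)) ℂ) (n : Λ → ℕ) : Prop where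
  irreducible : ∀ l, (unitaryRep (σ l)).IsIrreducible
  inequivalent : ∀ l l', l ≠ l' →
    IsEmpty ((unitaryRep (σ l)).Equiv (unitaryRep (σ l')))
  equiv : ∃ e : Op d ≃ₗ[ℂ] (∀ l, Fin (n l) → Fin (D l) → ℂ),
    ∀ g X l j, e (ω g X) l j = unitaryRep (σ l) g (e X l j)

/-- The Fourier transform `ℱ(φ)[σ] = |G|⁻¹ ∑_g conj(σ(g)) ⊗ φ(g)`. -/
def fourier {d k : ℕ} (φ : G → SuperOp d) (σ : G →* Matrix.unitaryGroup (Fin k) ℂ) :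
    Module.End ℂ ((Fin k → ℂ) ⊗[ℂ] Op d) :=
  (Fintype.card G : ℂ)⁻¹ • ∑ g, TensorProduct.map
    (Matrix.toLin' ((σ g : Matrix (Fin k) (Fin k) ℂ).map (starRingEnd ℂ))) (φ g)

/-- The map `φ_ν(g) = |G| ν(g) φ(g)`. -/
def weighted {d : ℕ} (ν : G → ℝ) (φ : G → SuperOp d) : G → SuperOp d :=
  fun g => ((Fintype.card G * ν g : ℝ) : ℂ) • φ g

end Group

/-! ### Dominant invariant subspaces -/

/-- `V` is a dominant invariant subspace of `T`: the span of all generalized eigenspaces that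
belong to the eigenvalues of absolute value greater than some threshold `r`. -/
def IsDominantInvariantSubspace {E : Type*} [AddCommGroup E] [Module ℂ E]
    (T : Module.End ℂ E) (V : Submodule ℂ E) : Prop :=
  ∃ r : ℝ, V = ⨆ μ : {μ : ℂ // r < ‖μ‖}, T.maxGenEigenspace (μ : ℂ)

/-- `M` is the matrix, in some basis, of the restriction of `T` to an `n`-dimensional dominant
invariant subspace. -/
def IsDominantBlock {E : Type*} [AddCommGroup E] [Module ℂ E] {n : ℕ}
    (T : Module.End ℂ E) (M : Matrix (Fin n) (Fin n) ℂ) : Prop :=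
  ∃ b : Fin n → E, LinearIndependent ℂ b ∧
    IsDominantInvariantSubspace T (Submodule.span ℂ (Set.range b)) ∧
    ∀ j, T (b j) = ∑ i, M i j • b i

/-! ### The error bound -/

/-- `2x([1 + 2x/(1-5x)][1 + x/(1-x)] + [2x/(1-5x)]² [x/(1-x)] [3 + 2x/(1-5x)])`. -/
def errorBound (x : ℝ) : ℝ :=
  2 * x * ((1 + 2 * x / (1 - 5 * x)) * (1 + x / (1 - x)) +
    (2 * x / (1 - 5 * x)) ^ 2 * (x / (1 - x)) * (3 + 2 * x / (1 - 5 * x)))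

end

end RB

/-!
A sequence of length `m` acts on functions `F : G → Op d` (the `h`-th entry being the unnormalised
state of the system when the product of the gates drawn so far is `h`) by the `m`-th power of the
convolution operator `(T F)(h) = ∑ g, ν g • φ g (F (g⁻¹ h))`. So the output probability is a
linear functional, the readout, of `T ^ m F₀`, with `F₀` concentrated at the identity. Measured in
the norm `∑ h, ‖F h‖₁`, the operator `T`, the readout and `F₀` all have norm at most one.

Let `P` be the same operator for the uniform distribution and the reference representation `ω`.
It is an idempotent contraction. Mixing and closeness together give
`‖T ^ m_mix - P‖ ≤ δ + δ' ≤ 1 / 9`: the powers of the convolution operators of `ω` and `φ` are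
compared by telescoping, and the convolution powers of `ν` with the uniform distribution directly
(`l1Seminorm_convOp_pow_sub_averaging_le`).

A Riccati equation, solved by the contraction principle, then produces a projection `Z` with the
same range as `P` whose kernel is invariant under `A = T ^ m_mix` (`exists_perturbed_projection`).
The powers of `A` decay like `(5 / 9) ^ k` on the kernel of `Z` and are bounded below by
`(5 / 6) ^ k` modulo that kernel. With any threshold in between, for which `2 / 3` is taken, the
kernel is the sum of the generalized eigenspaces of `T` with small eigenvalues, so the dominant
subspace is a complement of it and has dimension `rank P`
(`isCompl_dominantSubspace_slowSubmodule`). Moreover `A - P A Z` has norm at most the error bound.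
Replacing `T ^ m F₀ = A T ^ k F₀`, where `k = m - m_mix`, by `P A Z T ^ k F₀` therefore costs no
more than the error bound, for every `k` simultaneously.

The matrix coefficients of `σ` give maps from the space of the Fourier mode `ℱ(φ_ν)[σ]` to the
functions `G → Op d` which intertwine `ℱ(φ_ν)[σ]` with `T`, and which are jointly injective. Hence
the same perturbation argument applies to each Fourier mode. There `P` has rank `n_λ` by
orthogonality of characters. On functions the range of `P` lies in the span of matrix coefficients
of the `σ_λ` with `λ ∈ Λ`, so `F₀` is the sum of an element of the kernel of `Z` and of images of
vectors of dominant subspaces of Fourier modes. On the former `Z T ^ k` vanishes, and on the latter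
`T ^ k` acts through `M_λ ^ k`, which gives the signal `∑ λ, tr (A_λ M_λ ^ k)`.

Two facts about the trace norm make `1`-norm estimates possible: `‖X‖₁` is the least value of
`(tr P + tr Q) / 2` over positive block matrices `[[P, X], [Xᴴ, Q]]`, which completely positive maps
preserve, and `‖Φ‖_⋄` is finite and bounds `Φ` on `Op d`.
-/

namespace RB

open scoped TensorProduct ComplexOrder

/-! ### The trace norm -/

section TraceNorm

open Matrix

variable {ι κ : Type*} [Fintype ι] [Fintype κ] [DecidableEq ι] [DecidableEq κ]

/-- A singular value decomposition `X = W S Uᴴ`, with `U` unitary and `W` a partial isometry. The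
singular values are those whose sum defines `traceNorm X`. -/
theorem exists_singular_value_decomposition (X : Matrix ι ι ℂ) :
    ∃ (U W : Matrix ι ι ℂ) (s : ι → ℝ), (∀ i, 0 ≤ s i) ∧ ∑ i, s i = traceNorm X ∧
      Uᴴ * U = 1 ∧ U * Uᴴ = 1 ∧ W * Wᴴ * W = W ∧
      W * diagonal (fun i => (s i : ℂ)) * Uᴴ = X ∧
      Wᴴ * X * U = diagonal (fun i => (s i : ℂ)) ∧
      Wᴴ * W * diagonal (fun i => (s i : ℂ)) = diagonal (fun i => (s i : ℂ)) := by
  set H := Matrix.isHermitian_conjTranspose_mul_self X with hH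
  set lam : ι → ℝ := H.eigenvalues with hlam
  have hlam0 : ∀ i, 0 ≤ lam i := (posSemidef_conjTranspose_mul_self X).eigenvalues_nonneg
  set s : ι → ℝ := fun i => Real.sqrt (lam i) with hs
  have hss : ∀ i, s i * s i = lam i := fun i => Real.mul_self_sqrt (hlam0 i)
  set U : Matrix ι ι ℂ := (H.eigenvectorUnitary : Matrix ι ι ℂ) with hU
  have hUU : Uᴴ * U = 1 := Unitary.coe_star_mul_self H.eigenvectorUnitary
  have hUU' : U * Uᴴ = 1 := Unitary.coe_mul_star_self H.eigenvectorUnitary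
  have hdiag : Uᴴ * (Xᴴ * X) * U = diagonal (fun i => (lam i : ℂ)) := by
    have := H.conjStarAlgAut_star_eigenvectorUnitary
    rw [Unitary.conjStarAlgAut_star_apply] at this
    exact this
  set S : Matrix ι ι ℂ := diagonal (fun i => (s i : ℂ)) with hS
  set S' : Matrix ι ι ℂ := diagonal (fun i => (s i : ℂ)⁻¹) with hS'
  set W := X * U * S' with hW
  have hS'H : S'ᴴ = S' := by
    rw [hS', diagonal_conjTranspose]; congr 1; ext i; simp
  have hWW : Wᴴ * W = diagonal (fun i => (s i : ℂ)⁻¹ * lam i * (s i : ℂ)⁻¹) := by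
    have : Wᴴ * W = S' * (Uᴴ * (Xᴴ * X) * U) * S' := by
      rw [hW, conjTranspose_mul, conjTranspose_mul, hS'H]; simp only [Matrix.mul_assoc]
    rw [this, hdiag, hS', diagonal_mul_diagonal, diagonal_mul_diagonal]
  have hWXU : Wᴴ * X * U = S := by
    have : Wᴴ * X * U = S' * (Uᴴ * (Xᴴ * X) * U) := by
      rw [hW, conjTranspose_mul, conjTranspose_mul, hS'H]; simp only [Matrix.mul_assoc]
    rw [this, hdiag, hS', diagonal_mul_diagonal, hS]
    congr 1; ext i
    rw [← hss i, Complex.ofReal_mul]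
    by_cases h : (s i : ℂ) = 0
    · simp [h]
    · field_simp
  -- `S' S` is the projection onto the nonzero singular values; `X U` kills the other columns.
  have hXU : X * U * (S' * S) = X * U := by
    have hz : (X * U * (S' * S - 1))ᴴ * (X * U * (S' * S - 1)) = 0 := by
      have hD : (S' * S - 1)ᴴ = S' * S - 1 := by
        rw [hS', hS, diagonal_mul_diagonal, ← diagonal_one, diagonal_sub, diagonal_conjTranspose]
        congr 1; ext i; simp
      have : (X * U * (S' * S - 1))ᴴ * (X * U * (S' * S - 1))
          = (S' * S - 1) * (Uᴴ * (Xᴴ * X) * U) * (S' * S - 1) := by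
        rw [conjTranspose_mul, conjTranspose_mul, hD]; simp only [Matrix.mul_assoc]
      rw [this, hdiag, hS', hS, diagonal_mul_diagonal, ← diagonal_one, diagonal_sub,
        diagonal_mul_diagonal, diagonal_mul_diagonal, ← diagonal_zero]
      congr 1; ext i
      rw [← hss i, Complex.ofReal_mul]
      by_cases h : (s i : ℂ) = 0
      · simp [h]
      · field_simp; simp
    have := conjTranspose_mul_self_eq_zero.1 hz
    rwa [Matrix.mul_sub, Matrix.mul_one, sub_eq_zero] at this
  refine ⟨U, W, s, fun i => Real.sqrt_nonneg _, rfl, hUU, hUU', ?_, ?_, hWXU, ?_⟩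
  · rw [Matrix.mul_assoc, hWW, hW, hS', Matrix.mul_assoc, diagonal_mul_diagonal]
    congr 2; ext i
    rw [← hss i, Complex.ofReal_mul]
    by_cases h : (s i : ℂ) = 0
    · simp [h]
    · field_simp
  · rw [hW, Matrix.mul_assoc (X * U), hXU, Matrix.mul_assoc, hUU', Matrix.mul_one]
  · rw [hWW, diagonal_mul_diagonal]
    congr 1; ext i
    rw [← hss i, Complex.ofReal_mul]
    by_cases h : (s i : ℂ) = 0
    · simp [h]
    · field_simp

theorem traceNorm_nonneg (X : Matrix ι ι ℂ) : 0 ≤ traceNorm X :=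
  Finset.sum_nonneg fun _ _ => Real.sqrt_nonneg _

/-- The block matrix `[[P, X], [Xᴴ, Q]]` is positive semidefinite. Then `P` and `Q` dominate `X` in
the sense of `IsDominatedBy.traceNorm_le`. -/
def IsDominatedBy (X P Q : Matrix ι ι ℂ) : Prop := (fromBlocks P X Xᴴ Q).PosSemidef

/-- Take `P = W S Wᴴ` and `Q = U S Uᴴ` for a singular value decomposition `X = W S Uᴴ`. -/
theorem exists_isDominatedBy (X : Matrix ι ι ℂ) : ∃ P Q, IsDominatedBy X P Q ∧
    P.trace.re = traceNorm X ∧ Q.trace.re = traceNorm X := by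
  obtain ⟨U, W, s, hs0, hsum, hUU, -, -, hX, -, hWS⟩ := exists_singular_value_decomposition X
  set S : Matrix ι ι ℂ := diagonal (fun i => (s i : ℂ)) with hS
  set R : Matrix ι ι ℂ := diagonal (fun i => (Real.sqrt (s i) : ℂ)) with hR
  have hRH : Rᴴ = R := by
    rw [hR, diagonal_conjTranspose]; congr 1; ext i; simp
  have hRR : R * R = S := by
    rw [hR, hS, diagonal_mul_diagonal]; congr 1; ext i
    rw [← Complex.ofReal_mul, Real.mul_self_sqrt (hs0 i)]
  have htr : S.trace.re = traceNorm X := by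
    rw [hS, trace_diagonal, ← Complex.ofReal_sum, Complex.ofReal_re, hsum]
  refine ⟨W * S * Wᴴ, U * S * Uᴴ, ?_, ?_, ?_⟩
  · have := posSemidef_self_mul_conjTranspose (fromRows (W * R) (U * R))
    rw [conjTranspose_fromRows_eq_fromCols_conjTranspose, fromRows_mul_fromCols] at this
    have hXH : Xᴴ = U * S * Wᴴ := by
      rw [← hX, conjTranspose_mul, conjTranspose_mul, conjTranspose_conjTranspose, ← hRR,
        conjTranspose_mul, hRH, ← Matrix.mul_assoc]
    have e : ∀ A B : Matrix ι ι ℂ, A * R * (B * R)ᴴ = A * S * Bᴴ := by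
      intro A B
      rw [conjTranspose_mul, hRH, ← hRR]; simp only [Matrix.mul_assoc]
    rw [e, e, e, e, hX, ← hXH] at this
    exact this
  · rw [trace_mul_comm, ← Matrix.mul_assoc, hWS, htr]
  · rw [trace_mul_comm, ← Matrix.mul_assoc, hUU, Matrix.one_mul, htr]

omit [DecidableEq ι] [DecidableEq κ] in
/-- The compression of the block matrix by the column `[A, -B]` has nonnegative trace. -/
theorem IsDominatedBy.two_mul_re_trace_le {X P Q : Matrix ι ι ℂ} (h : IsDominatedBy X P Q)
    (A B : Matrix ι κ ℂ) :
    2 * ((Aᴴ * X * B).trace).re ≤ ((Aᴴ * P * A).trace).re + ((Bᴴ * Q * B).trace).re := by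
  have h1 := (h.conjTranspose_mul_mul_same (fromRows A (-B))).trace_nonneg
  have e : (fromRows A (-B))ᴴ * fromBlocks P X Xᴴ Q * fromRows A (-B)
      = Aᴴ * P * A - Aᴴ * X * B - (Aᴴ * X * B)ᴴ + Bᴴ * Q * B := by
    rw [conjTranspose_fromRows_eq_fromCols_conjTranspose, fromCols_mul_fromBlocks,
      fromCols_mul_fromRows]
    simp only [conjTranspose_mul, conjTranspose_conjTranspose, conjTranspose_neg, Matrix.add_mul,
      Matrix.neg_mul, Matrix.mul_neg, Matrix.mul_assoc]
    abel
  rw [e, trace_add, trace_sub, trace_sub, trace_conjTranspose] at h1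
  have h2 := (Complex.le_def.1 h1).1
  simp only [Complex.add_re, Complex.sub_re, Complex.zero_re, Complex.star_def,
    Complex.conj_re] at h2
  linarith

omit [Fintype ι] [DecidableEq ι] in
theorem IsDominatedBy.left {X P Q : Matrix ι ι ℂ} (h : IsDominatedBy X P Q) : P.PosSemidef :=
  h.submatrix Sum.inl

omit [Fintype ι] [DecidableEq ι] in
theorem IsDominatedBy.right {X P Q : Matrix ι ι ℂ} (h : IsDominatedBy X P Q) : Q.PosSemidef :=
  h.submatrix Sum.inr

omit [DecidableEq κ] in
/-- Compression by a partial isometry does not increase the trace of a positive matrix. -/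
theorem trace_conj_le {P : Matrix ι ι ℂ} (hP : P.PosSemidef) {V : Matrix ι κ ℂ}
    (hV : V * Vᴴ * V = V) : ((Vᴴ * P * V).trace).re ≤ P.trace.re := by
  have h1 := (hP.conjTranspose_mul_mul_same (1 - V * Vᴴ)).trace_nonneg
  have hid : (1 - V * Vᴴ) * (1 - V * Vᴴ)ᴴ = 1 - V * Vᴴ := by
    rw [conjTranspose_sub, conjTranspose_mul, conjTranspose_conjTranspose, conjTranspose_one,
      Matrix.mul_sub, Matrix.mul_one, Matrix.sub_mul, Matrix.one_mul, ← Matrix.mul_assoc, hV,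
      sub_self, sub_zero]
  rw [Matrix.mul_assoc, trace_mul_comm, Matrix.mul_assoc, hid, Matrix.mul_sub, Matrix.mul_one,
    trace_sub, ← Matrix.mul_assoc, trace_mul_comm, ← Matrix.mul_assoc] at h1
  have h2 := (Complex.le_def.1 h1).1
  simp only [Complex.sub_re, Complex.zero_re] at h2
  linarith

/-- Together with `exists_isDominatedBy` this exhibits the trace norm as a minimum over positive
block matrices. -/
theorem IsDominatedBy.traceNorm_le {X P Q : Matrix ι ι ℂ} (h : IsDominatedBy X P Q) :
    traceNorm X ≤ (P.trace.re + Q.trace.re) / 2 := by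
  obtain ⟨U, W, s, -, hsum, hUU, hUU', hW, -, hWXU, -⟩ := exists_singular_value_decomposition X
  have h1 := h.two_mul_re_trace_le W U
  have h2 := trace_conj_le h.left hW
  have h3 := trace_conj_le h.right (V := U) (by rw [hUU', Matrix.one_mul])
  rw [hWXU, trace_diagonal, ← Complex.ofReal_sum, Complex.ofReal_re, hsum] at h1
  linarith

omit [DecidableEq ι] [DecidableEq κ] in
theorem IsDominatedBy.conj {X P Q : Matrix ι ι ℂ} (h : IsDominatedBy X P Q) (A B : Matrix ι κ ℂ) :
    IsDominatedBy (Aᴴ * X * B) (Aᴴ * P * A) (Bᴴ * Q * B) := by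
  have h1 := h.conjTranspose_mul_mul_same (fromBlocks A 0 0 B)
  rw [fromBlocks_conjTranspose, fromBlocks_multiply, fromBlocks_multiply] at h1
  simpa [IsDominatedBy, Matrix.mul_assoc] using h1

theorem traceNorm_conj_le (X : Matrix ι ι ℂ) {V : Matrix ι κ ℂ} (hV : V * Vᴴ * V = V) :
    traceNorm (Vᴴ * X * V) ≤ traceNorm X := by
  obtain ⟨P, Q, h, hP, hQ⟩ := exists_isDominatedBy X
  have := (h.conj V V).traceNorm_le
  linarith [trace_conj_le h.left hV, trace_conj_le h.right hV]

theorem traceNorm_add_le (X Y : Matrix ι ι ℂ) : traceNorm (X + Y) ≤ traceNorm X + traceNorm Y := by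
  obtain ⟨P, Q, h, hP, hQ⟩ := exists_isDominatedBy X
  obtain ⟨P', Q', h', hP', hQ'⟩ := exists_isDominatedBy Y
  have h2 : IsDominatedBy (X + Y) (P + P') (Q + Q') := by
    have := PosSemidef.add h h'
    rw [fromBlocks_add, ← conjTranspose_add] at this
    exact this
  have := h2.traceNorm_le
  rw [trace_add, trace_add, Complex.add_re, Complex.add_re] at this
  linarith

theorem traceNorm_smul_le (c : ℂ) (X : Matrix ι ι ℂ) : traceNorm (c • X) ≤ ‖c‖ * traceNorm X := by
  obtain ⟨P, Q, h, hP, hQ⟩ := exists_isDominatedBy X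
  set r : ℝ := Real.sqrt ‖c‖ with hr
  have hrr : r * r = ‖c‖ := Real.mul_self_sqrt (norm_nonneg _)
  -- For `c = 0` the convention `0 / 0 = 0` makes `α` vanish, as it should.
  set α : ℂ := starRingEnd ℂ (c / r) with hα
  have h1 := (h.conj (α • (1 : Matrix ι ι ℂ)) ((r : ℂ) • (1 : Matrix ι ι ℂ))).traceNorm_le
  have hc : c / r * r = c := by
    by_cases h0 : (r : ℂ) = 0
    · have : r = 0 := by exact_mod_cast h0
      have : c = 0 := by rw [this] at hrr; simpa using hrr.symm
      simp [this]
    · field_simp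
  have hcc : (c / r) * α = (‖c‖ : ℝ) := by
    rw [hα, Complex.mul_conj, Complex.normSq_eq_norm_sq, norm_div, Complex.norm_real,
      Real.norm_of_nonneg (Real.sqrt_nonneg _), div_pow, sq r, hrr, sq]
    congr 1
    by_cases h0 : ‖c‖ = 0
    · simp [h0]
    · field_simp
  have e1 : (α • (1 : Matrix ι ι ℂ))ᴴ * X * ((r : ℂ) • (1 : Matrix ι ι ℂ)) = c • X := by
    rw [conjTranspose_smul, conjTranspose_one, hα, Complex.star_def, Complex.conj_conj,
      Matrix.smul_mul, Matrix.one_mul, Matrix.mul_smul, Matrix.mul_one, smul_smul, mul_comm, hc]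
  have e2 : (α • (1 : Matrix ι ι ℂ))ᴴ * P * (α • (1 : Matrix ι ι ℂ)) = ((‖c‖ : ℝ) : ℂ) • P := by
    rw [conjTranspose_smul, conjTranspose_one, ← hcc, hα, Complex.star_def, Complex.conj_conj,
      Matrix.smul_mul, Matrix.one_mul, Matrix.mul_smul, Matrix.mul_one, smul_smul, mul_comm]
  have e3 : ((r : ℂ) • (1 : Matrix ι ι ℂ))ᴴ * Q * ((r : ℂ) • (1 : Matrix ι ι ℂ))
      = ((‖c‖ : ℝ) : ℂ) • Q := by
    rw [conjTranspose_smul, conjTranspose_one, Complex.star_def, Complex.conj_ofReal,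
      Matrix.smul_mul, Matrix.one_mul, Matrix.mul_smul, Matrix.mul_one, smul_smul,
      ← Complex.ofReal_mul, hrr]
  rw [e1, e2, e3, trace_smul, trace_smul, smul_eq_mul, smul_eq_mul, Complex.re_ofReal_mul,
    Complex.re_ofReal_mul, hP, hQ] at h1
  linarith

theorem norm_entry_le_traceNorm (X : Matrix ι ι ℂ) (i j : ι) : ‖X i j‖ ≤ traceNorm X := by
  obtain ⟨P, Q, h, hP, hQ⟩ := exists_isDominatedBy X
  obtain ⟨c, hc1, hc⟩ : ∃ c : ℂ, ‖c‖ = 1 ∧ X i j * c = ‖X i j‖ := by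
    by_cases h0 : X i j = 0
    · exact ⟨1, by simp, by simp [h0]⟩
    · have h0' : ‖X i j‖ ≠ 0 := norm_ne_zero_iff.2 h0
      refine ⟨starRingEnd ℂ (X i j) / ‖X i j‖, by simp [h0'], ?_⟩
      rw [mul_div_assoc', Complex.mul_conj, Complex.normSq_eq_norm_sq, sq, Complex.ofReal_mul,
        mul_div_assoc, div_self (by exact_mod_cast h0'), mul_one]
  have hcc : starRingEnd ℂ c * c = 1 := by
    rw [mul_comm, Complex.mul_conj, Complex.normSq_eq_norm_sq, hc1]; norm_num
  have key : ∀ (M : Matrix ι ι ℂ) (k l : ι) (a b : ℂ),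
      ((Matrix.single k (0 : Fin 1) a)ᴴ * M * Matrix.single l (0 : Fin 1) b).trace
        = star a * M k l * b := by
    intro M k l a b
    rw [conjTranspose_single]
    simp [Matrix.trace]
  have h1 := h.two_mul_re_trace_le (Matrix.single i (0 : Fin 1) (1 : ℂ))
    (Matrix.single j (0 : Fin 1) c)
  rw [key, key, key] at h1
  have e1 : star c * Q j j * c = Q j j := by
    rw [mul_right_comm, Complex.star_def, hcc, one_mul]
  rw [e1, star_one, one_mul, one_mul, mul_one, hc, Complex.ofReal_re] at h1
  have hd : ∀ (M : Matrix ι ι ℂ), M.PosSemidef → ∀ k, (M k k).re ≤ M.trace.re := by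
    intro M hM k
    rw [Matrix.trace, Complex.re_sum]
    exact Finset.single_le_sum (f := fun k => (M k k).re)
      (fun k _ => (Complex.le_def.1 hM.diag_nonneg).1) (Finset.mem_univ k)
  linarith [hd P h.left i, hd Q h.right j]

/-- The trace norm as a seminorm. That it is definite is `eq_zero_of_traceNorm_eq_zero`. -/
noncomputable def traceSeminorm (ι : Type*) [Fintype ι] [DecidableEq ι] :
    Seminorm ℂ (Matrix ι ι ℂ) :=
  Seminorm.ofSMulLE traceNorm
    (le_antisymm (by simpa using traceNorm_smul_le 0 (0 : Matrix ι ι ℂ)) (traceNorm_nonneg _))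
    traceNorm_add_le traceNorm_smul_le

@[simp]
theorem traceSeminorm_apply (X : Matrix ι ι ℂ) : traceSeminorm ι X = traceNorm X := rfl

theorem eq_zero_of_traceNorm_eq_zero {X : Matrix ι ι ℂ} (h : traceNorm X = 0) : X = 0 := by
  ext i j
  simpa [h] using norm_entry_le_traceNorm X i j

open scoped MatrixOrder in
theorem exists_eq_conjTranspose_mul_self {E : Matrix ι ι ℂ} (hE : E.PosSemidef) :
    ∃ R : Matrix ι ι ℂ, E = Rᴴ * R := by
  obtain ⟨R, hR⟩ := CStarAlgebra.nonneg_iff_eq_star_mul_self.mp hE.nonneg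
  exact ⟨R, hR⟩

theorem re_trace_mul_nonneg {E P : Matrix ι ι ℂ} (hE : E.PosSemidef) (hP : P.PosSemidef) :
    0 ≤ (E * P).trace.re := by
  obtain ⟨R, rfl⟩ := exists_eq_conjTranspose_mul_self hE
  have h := (hP.mul_mul_conjTranspose_same R).trace_nonneg
  rw [trace_mul_comm, ← Matrix.mul_assoc] at h
  exact (Complex.le_def.1 h).1

theorem re_trace_effect_mul_le {E : Matrix ι ι ℂ} (hE : E.PosSemidef)
    (hE1 : (1 - E).PosSemidef) (X : Matrix ι ι ℂ) :
    ((E * X).trace).re ≤ traceNorm X := by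
  obtain ⟨P, Q, h, hP, hQ⟩ := exists_isDominatedBy X
  obtain ⟨R, hR⟩ := exists_eq_conjTranspose_mul_self hE
  have key : ∀ M : Matrix ι ι ℂ, (Rᴴᴴ * M * Rᴴ).trace = (E * M).trace := by
    intro M
    rw [hR, trace_mul_comm, ← Matrix.mul_assoc, conjTranspose_conjTranspose]
  have h1 := h.two_mul_re_trace_le Rᴴ Rᴴ
  rw [key, key, key] at h1
  have h2 := re_trace_mul_nonneg hE1 h.left
  have h3 := re_trace_mul_nonneg hE1 h.right
  rw [Matrix.sub_mul, Matrix.one_mul, trace_sub, Complex.sub_re] at h2 h3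
  linarith

theorem norm_trace_effect_mul_le {E : Matrix ι ι ℂ} (hE : E.PosSemidef)
    (hE1 : (1 - E).PosSemidef) (X : Matrix ι ι ℂ) :
    ‖(E * X).trace‖ ≤ traceNorm X := by
  set z := (E * X).trace with hz
  by_cases h0 : z = 0
  · rw [h0, norm_zero]; exact traceNorm_nonneg X
  have h0' : ‖z‖ ≠ 0 := norm_ne_zero_iff.2 h0
  set c : ℂ := starRingEnd ℂ z / ‖z‖ with hc
  have hc1 : ‖c‖ = 1 := by simp [hc, h0']
  have h1 := re_trace_effect_mul_le hE hE1 (c • X)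
  have h2 := traceNorm_smul_le c X
  have h3 : c * z = ‖z‖ := by
    rw [hc, div_mul_eq_mul_div, mul_comm, Complex.mul_conj, Complex.normSq_eq_norm_sq, sq,
      Complex.ofReal_mul, mul_div_assoc, div_self (by exact_mod_cast h0'), mul_one]
  rw [Matrix.mul_smul, trace_smul, ← hz, smul_eq_mul, h3, Complex.ofReal_re] at h1
  rw [hc1, one_mul] at h2
  exact h1.trans h2

end TraceNorm

/-! ### Completely positive maps and the diamond norm -/

section Channels

open Matrix

variable {d : ℕ}

theorem IsCompletelyPositive.isDominatedBy {Φ : SuperOp d} (hΦ : IsCompletelyPositive Φ)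
    {X P Q : Op d} (h : IsDominatedBy X P Q) : IsDominatedBy (Φ X) (Φ P) (Φ Q) := by
  -- The block matrix is an operator on `ℂ^d ⊗ ℂ^2`, so two-positivity of `Φ` applies.
  set e : Fin d × Fin 2 → Fin d ⊕ Fin d := fun p => if p.2 = 0 then .inl p.1 else .inr p.1
    with he
  have h1 := (hΦ 2 _ (h.submatrix e)).submatrix
    (Sum.elim (fun i => (i, (0 : Fin 2))) (fun i => (i, (1 : Fin 2))))
  have h2 : (ampliation 2 Φ ((fromBlocks P X Xᴴ Q).submatrix e e)).submatrix
      (Sum.elim (fun i => (i, (0 : Fin 2))) (fun i => (i, (1 : Fin 2))))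
      (Sum.elim (fun i => (i, (0 : Fin 2))) (fun i => (i, (1 : Fin 2))))
      = fromBlocks (Φ P) (Φ X) (Φ Xᴴ) (Φ Q) := by
    ext (i | i) (j | j) <;> rfl
  rw [h2] at h1
  have h3 := (isHermitian_fromBlocks_iff.1 h1.isHermitian).2.1
  rw [← h3] at h1
  exact h1

/-- Completely positive trace-nonincreasing maps are contractions for the trace norm, also on
operators that are not self-adjoint. -/
theorem traceNorm_map_le {Φ : SuperOp d} (hΦ : IsCompletelyPositive Φ)
    (hΦ' : IsTraceNonincreasing Φ) (X : Op d) : traceNorm (Φ X) ≤ traceNorm X := by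
  obtain ⟨P, Q, h, hP, hQ⟩ := exists_isDominatedBy X
  have := (hΦ.isDominatedBy h).traceNorm_le
  linarith [hΦ' P h.left, hΦ' Q h.right]

theorem IsQuantumChannel.isTraceNonincreasing {Φ : SuperOp d} (hΦ : IsQuantumChannel Φ) :
    IsTraceNonincreasing Φ := fun X _ => by rw [hΦ.tracePreserving]

theorem IsQuantumChannel.traceNorm_map_le {Φ : SuperOp d} (hΦ : IsQuantumChannel Φ) (X : Op d) :
    traceNorm (Φ X) ≤ traceNorm X :=
  RB.traceNorm_map_le hΦ.completelyPositive hΦ.isTraceNonincreasing X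

theorem traceNorm_le_trace {ι : Type*} [Fintype ι] [DecidableEq ι] {X : Matrix ι ι ℂ}
    (hX : X.PosSemidef) : traceNorm X ≤ X.trace.re := by
  have h : IsDominatedBy X X X := by
    have := hX.conjTranspose_mul_mul_same (fromCols (1 : Matrix ι ι ℂ) (1 : Matrix ι ι ℂ))
    rw [conjTranspose_fromCols_eq_fromRows_conjTranspose, fromRows_mul,
      fromRows_mul_fromCols] at this
    simpa [IsDominatedBy, hX.isHermitian.eq] using this
  have := h.traceNorm_le
  linarith

theorem ampliation_add (Φ : SuperOp d) (k : ℕ) (X Y : Matrix (Fin d × Fin k) (Fin d × Fin k) ℂ) :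
    ampliation k Φ (X + Y) = ampliation k Φ X + ampliation k Φ Y := by
  ext p q
  exact congrFun (congrFun (map_add Φ (Matrix.of fun i j => X (i, p.2) (j, q.2))
    (Matrix.of fun i j => Y (i, p.2) (j, q.2))) p.1) q.1

theorem ampliation_smul (Φ : SuperOp d) (k : ℕ) (c : ℂ)
    (X : Matrix (Fin d × Fin k) (Fin d × Fin k) ℂ) :
    ampliation k Φ (c • X) = c • ampliation k Φ X := by
  ext p q
  exact congrFun (congrFun (map_smul Φ c (Matrix.of fun i j => X (i, p.2) (j, q.2))) p.1) q.1

/-- `ampliation k Φ` as a linear map. -/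
def ampliationHom (k : ℕ) (Φ : SuperOp d) :
    Module.End ℂ (Matrix (Fin d × Fin k) (Fin d × Fin k) ℂ) where
  toFun := ampliation k Φ
  map_add' := ampliation_add Φ k
  map_smul' := ampliation_smul Φ k

theorem seminorm_sum_le {V α : Type*} [AddCommGroup V] [Module ℂ V] (N : Seminorm ℂ V)
    (s : Finset α) (f : α → V) : N (∑ i ∈ s, f i) ≤ ∑ i ∈ s, N (f i) :=
  Finset.le_sum_of_subadditive N (map_zero N).le (map_add_le_add N) s f

/-- Linear maps are bounded for the trace norm. This makes the set whose supremum is the diamond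
norm bounded above. -/
theorem exists_traceNorm_map_le {ι : Type*} [Fintype ι] [DecidableEq ι]
    (f : Module.End ℂ (Matrix ι ι ℂ)) : ∃ C, ∀ X, traceNorm (f X) ≤ C * traceNorm X := by
  refine ⟨∑ i, ∑ j, traceNorm (f (single i j 1)), fun X => ?_⟩
  have e : f X = ∑ i, ∑ j, X i j • f (single i j 1) := by
    conv_lhs => rw [matrix_eq_sum_single X]
    simp only [map_sum]
    refine Finset.sum_congr rfl fun i _ => Finset.sum_congr rfl fun j _ => ?_
    rw [← map_smul, smul_single, smul_eq_mul, mul_one]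
  rw [e, Finset.sum_mul]
  refine (seminorm_sum_le (traceSeminorm ι) _ _).trans (Finset.sum_le_sum fun i _ => ?_)
  rw [Finset.sum_mul]
  refine (seminorm_sum_le (traceSeminorm ι) _ _).trans (Finset.sum_le_sum fun j _ => ?_)
  rw [map_smul_eq_mul, mul_comm]
  exact mul_le_mul_of_nonneg_left (norm_entry_le_traceNorm X i j) (apply_nonneg _ _)

theorem traceNorm_ampliation_le (Φ : SuperOp d) (X : Matrix (Fin d × Fin d) (Fin d × Fin d) ℂ) :
    traceNorm (ampliation d Φ X) ≤ diamondNorm Φ * traceNorm X := by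
  obtain ⟨C, hC⟩ := exists_traceNorm_map_le (ampliationHom d Φ)
  have hbdd : BddAbove {t : ℝ | ∃ X : Matrix (Fin d × Fin d) (Fin d × Fin d) ℂ,
      traceNorm X ≤ 1 ∧ t = traceNorm (ampliation d Φ X)} := by
    refine ⟨|C|, ?_⟩
    rintro t ⟨X, hX, rfl⟩
    calc traceNorm (ampliation d Φ X) ≤ C * traceNorm X := hC X
      _ ≤ |C| * 1 := mul_le_mul (le_abs_self C) hX (traceNorm_nonneg _) (abs_nonneg _)
      _ = |C| := mul_one _
  have hhom := fun c X => map_smul_eq_mul (traceSeminorm (Fin d × Fin d)) c X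
  simp only [traceSeminorm_apply] at hhom
  rcases (traceNorm_nonneg X).eq_or_lt with h0 | h0
  · rw [eq_zero_of_traceNorm_eq_zero h0.symm]
    have := hhom 0 0
    rw [zero_smul, norm_zero, zero_mul] at this
    have e : ampliation d Φ 0 = 0 := map_zero (ampliationHom d Φ)
    rw [e, this, mul_zero]
  · have h1 : traceNorm (((traceNorm X)⁻¹ : ℂ) • X) ≤ 1 := by
      rw [hhom, norm_inv, Complex.norm_real, Real.norm_of_nonneg h0.le, inv_mul_cancel₀ h0.ne']
    have h2 := le_csSup hbdd ⟨_, h1, rfl⟩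
    rw [ampliation_smul, hhom, norm_inv, Complex.norm_real, Real.norm_of_nonneg h0.le,
      inv_mul_le_iff₀ h0, mul_comm] at h2
    exact h2

theorem traceNorm_map_le_diamondNorm (Φ : SuperOp d) (X : Op d) :
    traceNorm (Φ X) ≤ diamondNorm Φ * traceNorm X := by
  rcases d.eq_zero_or_pos with rfl | hd
  · have h : traceNorm (Φ X) = 0 := by simp [traceNorm]
    have h' : traceNorm X = 0 := by simp [traceNorm]
    rw [h, h', mul_zero]
  · -- Tensoring with a fixed rank one projection is conjugation by an isometry `V`.
    set V : Matrix (Fin d × Fin d) (Fin d) ℂ :=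
      Matrix.of fun p j => if p.1 = j ∧ p.2 = ⟨0, hd⟩ then 1 else 0 with hV
    have hVV : Vᴴ * V = 1 := by
      ext i j
      simp [hV, Matrix.mul_apply, Fintype.sum_prod_type, Matrix.one_apply, ite_and, eq_comm]
    have happly : ∀ (Y : Op d) (p q : Fin d × Fin d), (V * Y * Vᴴ) p q
        = if p.2 = ⟨0, hd⟩ ∧ q.2 = ⟨0, hd⟩ then Y p.1 q.1 else 0 := by
      intro Y p q
      by_cases h1 : p.2 = ⟨0, hd⟩ <;> by_cases h2 : q.2 = ⟨0, hd⟩ <;>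
        simp [hV, Matrix.mul_apply, h1, h2, apply_ite]
    have hamp : ampliation d Φ (V * X * Vᴴ) = V * Φ X * Vᴴ := by
      ext p q
      rw [happly]
      change Φ (Matrix.of fun i j => (V * X * Vᴴ) (i, p.2) (j, q.2)) p.1 q.1 = _
      simp only [happly]
      split_ifs with h
      · rfl
      · change Φ 0 p.1 q.1 = 0
        rw [map_zero]; rfl
    have e : Φ X = Vᴴ * (V * Φ X * Vᴴ) * V := by
      rw [← Matrix.mul_assoc, ← Matrix.mul_assoc, hVV, Matrix.one_mul, Matrix.mul_assoc, hVV,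
        Matrix.mul_one]
    have hd0 : 0 ≤ diamondNorm Φ := Real.sSup_nonneg (by
      rintro t ⟨X, -, rfl⟩; exact traceNorm_nonneg _)
    calc traceNorm (Φ X) = traceNorm (Vᴴ * (V * Φ X * Vᴴ) * V) := by rw [← e]
      _ ≤ traceNorm (V * Φ X * Vᴴ) := traceNorm_conj_le _ (by
          rw [Matrix.mul_assoc, hVV, Matrix.mul_one])
      _ ≤ diamondNorm Φ * traceNorm (V * X * Vᴴ) := by
          rw [← hamp]; exact traceNorm_ampliation_le Φ _
      _ ≤ diamondNorm Φ * traceNorm X := by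
          refine mul_le_mul_of_nonneg_left ?_ hd0
          have := traceNorm_conj_le X (V := Vᴴ) (by
            rw [conjTranspose_conjTranspose, hVV, Matrix.one_mul])
          rwa [conjTranspose_conjTranspose] at this

theorem IsPOVM.posSemidef_one_sub {I : Type*} [Fintype I] {E : I → Op d} (hE : IsPOVM E) (i : I) :
    (1 - E i).PosSemidef := by
  classical
  rw [← hE.sum_eq_one, ← Finset.sum_erase_add _ _ (Finset.mem_univ i), add_sub_cancel_right]
  exact posSemidef_sum _ fun j _ => hE.posSemidef j

end Channels

/-! ### Perturbation of a projection in a Banach algebra -/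

/-- The operator Riccati equation expressing that the graph `{w + Y w}` over the kernel of the
idempotent `P` is invariant under `P + E`. The right-hand side is a contraction of the ball of
radius `a` among the `Y` with `P Y = Y` and `Y P = 0`. -/
theorem exists_riccati_solution {R : Type*} [NormedRing R] [CompleteSpace R] {P E : R}
    (hP : P * P = P) (hP1 : ‖P‖ ≤ 1) (hQ : ‖1 - P‖ ≤ 2) {x a : ℝ} (hE : ‖E‖ ≤ x)
    (ha : 0 ≤ a) (hself : 2 * x + 3 * x * a + x * a ^ 2 ≤ a) (hcontr : (3 + 2 * a) * x < 1) :
    ∃ Y : R, P * Y = Y ∧ Y * P = 0 ∧ ‖Y‖ ≤ a ∧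
      Y = -(P * E * (1 - P)) + Y * E * (1 - P) + Y * E * Y - P * E * Y := by
  have hx : 0 ≤ x := (norm_nonneg _).trans hE
  set f : R → R := fun Y => -(P * E * (1 - P)) + Y * E * (1 - P) + Y * E * Y - P * E * Y with hf
  set s : Set R := {Y | P * Y = Y ∧ Y * P = 0 ∧ ‖Y‖ ≤ a} with hs
  have mul3 : ∀ (u v w : R) {α β γ : ℝ}, ‖u‖ ≤ α → ‖v‖ ≤ β → ‖w‖ ≤ γ →
      ‖u * v * w‖ ≤ α * β * γ := by
    intro u v w α β γ hu hv hw
    have hα := (norm_nonneg _).trans hu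
    have hβ := (norm_nonneg _).trans hv
    exact (norm_mul_le _ _).trans
      (mul_le_mul ((norm_mul_le _ _).trans (mul_le_mul hu hv (norm_nonneg _) hα)) hw
        (norm_nonneg _) (by positivity))
  have hclosed : IsClosed s := by
    have c1 : IsClosed {Y : R | P * Y = Y} := isClosed_eq (by fun_prop) (by fun_prop)
    have c2 : IsClosed {Y : R | Y * P = 0} := isClosed_eq (by fun_prop) (by fun_prop)
    have c3 : IsClosed {Y : R | ‖Y‖ ≤ a} := isClosed_le (by fun_prop) (by fun_prop)
    exact c1.inter (c2.inter c3)
  have hmaps : Set.MapsTo f s s := by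
    rintro Y ⟨h1, h2, h3⟩
    refine ⟨?_, ?_, ?_⟩
    · simp only [hf, mul_add, mul_sub, mul_neg, ← mul_assoc, hP, h1]
    · simp only [hf, add_mul, sub_mul, neg_mul, mul_assoc, h2, hP, mul_zero, one_mul, sub_self]
      simp
    · have e1 := mul3 P E (1 - P) hP1 hE hQ
      have e2 := mul3 Y E (1 - P) h3 hE hQ
      have e3 := mul3 Y E Y h3 hE h3
      have e4 := mul3 P E Y hP1 hE h3
      calc ‖f Y‖ ≤ ‖P * E * (1 - P)‖ + ‖Y * E * (1 - P)‖ + ‖Y * E * Y‖ + ‖P * E * Y‖ := by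
            refine (norm_sub_le _ _).trans (add_le_add_left ?_ _)
            refine (norm_add_le _ _).trans (add_le_add_left ?_ _)
            refine (norm_add_le _ _).trans (add_le_add_left ?_ _)
            rw [norm_neg]
        _ ≤ a := by linarith
  have hlip : ContractingWith ⟨(3 + 2 * a) * x, by positivity⟩ (hmaps.restrict f s s) := by
    refine ⟨by exact_mod_cast hcontr, LipschitzWith.of_dist_le_mul ?_⟩
    rintro ⟨Y, h1, h2, h3⟩ ⟨Y', h1', h2', h3'⟩
    rw [Subtype.dist_eq, Subtype.dist_eq, dist_eq_norm, dist_eq_norm]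
    change ‖f Y - f Y'‖ ≤ (3 + 2 * a) * x * ‖Y - Y'‖
    have e : f Y - f Y' = (Y - Y') * E * (1 - P) + (Y - Y') * E * Y + Y' * E * (Y - Y')
        - P * E * (Y - Y') := by
      simp only [hf]; noncomm_ring
    rw [e]
    have e1 := mul3 (Y - Y') E (1 - P) le_rfl hE hQ
    have e2 := mul3 (Y - Y') E Y le_rfl hE h3
    have e3 := mul3 Y' E (Y - Y') h3' hE le_rfl
    have e4 := mul3 P E (Y - Y') hP1 hE le_rfl
    refine (norm_sub_le _ _).trans ?_
    refine (add_le_add_left (norm_add_le _ _) _).trans ?_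
    refine (add_le_add_left (add_le_add_left (norm_add_le _ _) _) _).trans ?_
    linarith
  obtain ⟨Y, ⟨h1, h2, h3⟩, hfix, -⟩ := hlip.exists_fixedPoint' hclosed.isComplete hmaps
    (x := 0) ⟨by simp, by simp, by simpa⟩ (edist_ne_top _ _)
  exact ⟨Y, h1, h2, h3, hfix.symm⟩

/-- With `a = 2x / (1 - 5x)`, the norm estimate `2x + a x (2 + a)` from
`exists_perturbed_projection` is within the error bound, because `a² ≤ 2x / (1 - x)` for
`x ≤ 1 / 9`. -/
theorem errorBound_ge {x : ℝ} (hx : 0 < x) (hx9 : x ≤ 1 / 9) :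
    2 * x + (2 * x / (1 - 5 * x)) * x * (2 + 2 * x / (1 - 5 * x)) ≤ errorBound x := by
  have h5 : 0 < 1 - 5 * x := by linarith
  have h1 : 0 < 1 - x := by linarith
  unfold errorBound
  set a := 2 * x / (1 - 5 * x) with ha
  set b := x / (1 - x) with hb
  have ha0 : 0 ≤ a := by positivity
  have hb0 : 0 ≤ b := by positivity
  have key : a ^ 2 ≤ 2 * b := by
    rw [ha, hb, div_pow, mul_div_assoc', div_le_div_iff₀ (by positivity) h1]
    nlinarith [mul_nonneg hx.le (mul_nonneg (show 0 ≤ 1 - 3 * x by linarith)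
      (show 0 ≤ 1 - 9 * x by linarith))]
  have h2 : 0 ≤ a ^ 2 * b * (3 + a) := by positivity
  have h3 : 0 ≤ a * b := by positivity
  nlinarith [mul_nonneg hx.le h2, mul_nonneg hx.le h3, mul_nonneg hx.le (sub_nonneg.2 key)]

theorem errorBound_nonneg {x : ℝ} (hx : 0 < x) (hx9 : x ≤ 1 / 9) : 0 ≤ errorBound x := by
  have h5 : 0 < 1 - 5 * x := by linarith
  exact le_trans (by positivity) (errorBound_ge hx hx9)

theorem errorBound_le {x : ℝ} (hx : 0 < x) (hx9 : x ≤ 1 / 9) : errorBound x ≤ 4 * x := by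
  have h5 : 0 < 1 - 5 * x := by linarith
  have h1 : 0 < 1 - x := by linarith
  unfold errorBound
  set a := 2 * x / (1 - 5 * x) with ha
  set b := x / (1 - x) with hb
  have ha0 : 0 ≤ a := by positivity
  have hb0 : 0 ≤ b := by positivity
  have ha1 : a ≤ 1 / 2 := by rw [ha, div_le_iff₀ h5]; linarith
  have hb1 : b ≤ 1 / 8 := by rw [hb, div_le_iff₀ h1]; linarith
  have e1 : (1 + a) * (1 + b) ≤ (1 + 1 / 2) * (1 + 1 / 8) := by gcongr
  have e2 : a ^ 2 * b * (3 + a) ≤ (1 / 2) ^ 2 * (1 / 8) * (3 + 1 / 2) := by gcongr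
  have : (1 + a) * (1 + b) + a ^ 2 * b * (3 + a) ≤ 2 := by linarith
  nlinarith

/-- If `A` is within `1 / 9` of an idempotent `P` of norm at most one, there is an idempotent `Z`
with the range of `P` and an `A`-invariant kernel, on which the powers of `A` decay, while `Z A` is
within `1 / 6` of the identity on the range of `Z`. The last clause says that `P A Z` approximates
`A`. The idempotent is `Z = P - Y` for the solution `Y` of the Riccati equation. -/
theorem exists_perturbed_projection {R : Type*} [NormedRing R] [CompleteSpace R] {P A : R}
    (hP : P * P = P) (hP1 : ‖P‖ ≤ 1) (hQ : ‖1 - P‖ ≤ 2) {x : ℝ} (hE : ‖A - P‖ ≤ x)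
    (hx : 0 < x) (hx9 : x ≤ 1 / 9) :
    ∃ Z : R, Z * P = P ∧ P * Z = Z ∧ Z * A = Z * A * Z ∧
      Z * A = Z + Z * (A - P) * Z ∧ ‖Z * (A - P)‖ ≤ 1 / 6 ∧
      (∃ C, ∀ k, ‖A ^ k * (1 - Z)‖ ≤ C * (2 / 3) ^ k) ∧
      ‖A - P * A * Z‖ ≤ errorBound x := by
  have h5 : 0 < 1 - 5 * x := by linarith
  set a := 2 * x / (1 - 5 * x) with ha
  have ha0 : 0 ≤ a := by positivity
  have ha1 : a ≤ 1 / 2 := by rw [ha, div_le_iff₀ h5]; linarith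
  have haeq : a * (1 - 5 * x) = 2 * x := by
    rw [ha, div_mul_cancel₀ _ h5.ne']
  obtain ⟨Y, hPY, hYP, hYa, hY⟩ := exists_riccati_solution hP hP1 hQ hE ha0
    (by nlinarith [mul_nonneg ha0 hx.le]) (by nlinarith)
  set E := A - P with hEdef
  have hA : A = P + E := by rw [hEdef]; abel
  set Z := P - Y with hZ
  have hZP : Z * P = P := by rw [hZ, sub_mul, hP, hYP, sub_zero]
  have hPZ : P * Z = Z := by rw [hZ, mul_sub, hP, hPY]
  have hZZ : Z * Z = Z := by
    nth_rw 2 [← hPZ]; rw [← mul_assoc, hZP, hPZ]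
  have hinv : Z * A * (1 - Z) = 0 := by
    have e : Z * A * (1 - Z) = Y - (-(P * E * (1 - P)) + Y * E * (1 - P) + Y * E * Y - P * E * Y)
        + P * (P * Y - Y) + (P * Y - Y) - (P * P - P) * P - Y * P
        + Y * P * P - Y * P * Y := by
      rw [hZ, hA]; noncomm_ring
    rw [e, ← hY, hP, hPY, hYP]; simp
  have hZA : Z * A = Z * A * Z := by
    rw [mul_sub, mul_one, sub_eq_zero] at hinv; exact hinv
  have hZA' : Z * A = Z + Z * E * Z := by
    rw [hZA, hA, mul_add, hZP, add_mul, hPZ]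
  have hS : A * (1 - Z) = (1 - Z) * (A * (1 - Z)) := by
    rw [sub_mul, one_mul, ← mul_assoc Z, hinv, sub_zero]
  have hSQ : (1 - Z) * (1 - P) = 1 - Z := by
    rw [mul_sub, mul_one, sub_mul, one_mul, hZP, sub_self, sub_zero]
  have hQP : (1 - P) * P = 0 := by rw [sub_mul, hP, one_mul, sub_self]
  have hQA : (1 - P) * A = (1 - P) * E := by rw [hA, mul_add, hQP, zero_add]
  have hSnorm : ‖1 - Z‖ ≤ 2 + a := by
    have : 1 - Z = (1 - P) + Y := by rw [hZ]; abel
    rw [this]; exact (norm_add_le _ _).trans (add_le_add hQ hYa)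
  have hZnorm : ‖Z‖ ≤ 1 + a := (norm_sub_le _ _).trans (add_le_add hP1 hYa)
  have hQE : ‖(1 - P) * E‖ ≤ 2 * x :=
    (norm_mul_le _ _).trans (mul_le_mul hQ hE (norm_nonneg _) (by norm_num))
  refine ⟨Z, hZP, hPZ, hZA, hZA', ?_, ?_, ?_⟩
  · calc ‖Z * E‖ ≤ (1 + a) * x :=
          (norm_mul_le _ _).trans (mul_le_mul hZnorm hE (norm_nonneg _) (by positivity))
      _ ≤ (1 + 1 / 2) * (1 / 9) := by gcongr
      _ = 1 / 6 := by norm_num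
  · -- `D` is the action of `A` on the kernel of `Z`, transported to the kernel of `P`.
    set D := (1 - P) * A * (1 - Z) with hD
    have hDn : ‖D‖ ≤ 2 / 3 := by
      calc ‖D‖ ≤ 2 * x * (2 + a) := by
            rw [hD, hQA]
            exact (norm_mul_le _ _).trans (mul_le_mul hQE hSnorm (norm_nonneg _) (by positivity))
        _ ≤ 2 * (1 / 9) * (2 + 1 / 2) := by gcongr
        _ ≤ 2 / 3 := by norm_num
    have hsemi : SemiconjBy (1 - Z) D A := by
      change (1 - Z) * D = A * (1 - Z)
      rw [hD, mul_assoc (1 - P), ← mul_assoc, hSQ, ← hS]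
    refine ⟨‖1 - Z‖, fun k => ?_⟩
    rw [← (hsemi.pow_right k).eq]
    rcases k.eq_zero_or_pos with rfl | hk
    · simp
    · refine (norm_mul_le _ _).trans (mul_le_mul_of_nonneg_left ?_ (norm_nonneg _))
      exact (norm_pow_le' _ hk).trans (pow_le_pow_left₀ (norm_nonneg _) hDn _)
  · have e : A - P * A * Z = (1 - P) * E + Y * E * (1 - Z) := by
      have h1 : P * (A * (1 - Z)) = Y * E * (1 - Z) := by
        rw [hS, ← mul_assoc, ← mul_assoc]
        have h2 : P * (1 - Z) = Y := by rw [mul_sub, mul_one, hPZ, hZ]; abel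
        rw [h2, hA, mul_add, hYP, zero_add]
      rw [← h1, ← hQA]; noncomm_ring
    rw [e]
    refine (norm_add_le _ _).trans (le_trans ?_ (errorBound_ge hx hx9))
    refine add_le_add hQE ?_
    exact (norm_mul_le _ _).trans (mul_le_mul ((norm_mul_le _ _).trans
      (mul_le_mul hYa hE (norm_nonneg _) ha0)) hSnorm (norm_nonneg _) (by positivity))

/-! ### Dominant invariant subspaces of a perturbed projection -/

/-- `exists_perturbed_projection` for operators on a normed space. The kernel of `Z` is
characterised by the decay of the orbits of `A`, hence is invariant under everything that commutes
with `A`. -/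
theorem exists_dominant_projection_of_norm {V : Type*} [NormedAddCommGroup V] [NormedSpace ℂ V]
    [FiniteDimensional ℂ V] {P A : Module.End ℂ V} (hP : P * P = P) (hP1 : ∀ v, ‖P v‖ ≤ ‖v‖)
    {x : ℝ} (hx : 0 < x) (hx9 : x ≤ 1 / 9) (hE : ∀ v, ‖A v - P v‖ ≤ x * ‖v‖) :
    ∃ Z : Module.End ℂ V, Z * P = P ∧ P * Z = Z ∧
      (∀ v, Z v = 0 ↔ ∃ C : ℝ, ∀ k : ℕ, ‖(A ^ k) v‖ ≤ C * (2 / 3) ^ k) ∧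
      (∀ v, Z (A v) = Z (A (Z v))) ∧ (∀ v, 5 / 6 * ‖Z v‖ ≤ ‖Z (A v)‖) ∧
      ∀ v, ‖A v - P (A (Z v))‖ ≤ errorBound x * ‖v‖ := by
  have : CompleteSpace V := FiniteDimensional.complete ℂ V
  set φ := Module.End.toContinuousLinearMap (𝕜 := ℂ) V with hφ
  have hφv : ∀ (f : Module.End ℂ V) v, φ f v = f v := fun f v => rfl
  have hφs : ∀ (f : V →L[ℂ] V) v, φ.symm f v = f v := fun f v => rfl
  have hPn : ‖φ P‖ ≤ 1 := ContinuousLinearMap.opNorm_le_bound _ zero_le_one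
    fun v => by rw [one_mul, hφv]; exact hP1 v
  have hQn : ‖1 - φ P‖ ≤ 2 := by
    refine ContinuousLinearMap.opNorm_le_bound _ zero_le_two fun v => ?_
    calc ‖v - P v‖ ≤ ‖v‖ + ‖P v‖ := norm_sub_le _ _
      _ ≤ 2 * ‖v‖ := by linarith [hP1 v]
  have hEn : ‖φ A - φ P‖ ≤ x := ContinuousLinearMap.opNorm_le_bound _ hx.le fun v => hE v
  obtain ⟨Z, h1, h2, h3, h4, h5, ⟨C, h6⟩, h7⟩ :=
    exists_perturbed_projection (by rw [← map_mul, hP]) hPn hQn hEn hx hx9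
  have hlow : ∀ v, 5 / 6 * ‖Z v‖ ≤ ‖Z (A v)‖ := by
    intro v
    have e : Z (A v) = Z v + (Z * (φ A - φ P)) (Z v) := by
      exact congrArg (fun f : V →L[ℂ] V => f v) h4
    have h := (Z * (φ A - φ P)).le_of_opNorm_le h5 (Z v)
    have h' := norm_sub_le (Z (A v)) ((Z * (φ A - φ P)) (Z v))
    rw [e, add_sub_cancel_right, ← e] at h'
    linarith
  refine ⟨φ.symm Z, ?_, ?_, ?_, ?_, ?_, ?_⟩
  · apply φ.injective; rw [map_mul, φ.apply_symm_apply, h1]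
  · apply φ.injective; rw [map_mul, φ.apply_symm_apply, h2]
  · intro v
    rw [hφs]
    have hpow : ∀ k : ℕ, φ A ^ k = φ (A ^ k) := fun k => (map_pow φ A k).symm
    constructor
    · intro hv
      refine ⟨C * ‖v‖, fun k => ?_⟩
      have := (φ A ^ k * (1 - Z)).le_of_opNorm_le (h6 k) v
      rw [mul_apply_eq_comp, sub_apply, hv, sub_zero, hpow] at this
      calc ‖(A ^ k) v‖ ≤ C * (2 / 3) ^ k * ‖v‖ := this
        _ = C * ‖v‖ * (2 / 3) ^ k := by ring
    · rintro ⟨C', hC'⟩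
      by_contra hne
      have hpos : 0 < ‖Z v‖ := norm_pos_iff.2 hne
      have hgrow : ∀ k : ℕ, (5 / 6) ^ k * ‖Z v‖ ≤ ‖Z ((A ^ k) v)‖ := by
        intro k
        induction k with
        | zero => simp
        | succ k ih =>
          rw [pow_succ' A, Module.End.mul_apply, pow_succ']
          linarith [hlow ((A ^ k) v)]
      obtain ⟨k, hk⟩ := pow_unbounded_of_one_lt (‖Z‖ * C' / ‖Z v‖)
        (show (1 : ℝ) < 5 / 4 by norm_num)
      rw [div_lt_iff₀ hpos] at hk
      have e1 : (5 / 6 : ℝ) ^ k = (5 / 4) ^ k * (2 / 3) ^ k := by rw [← mul_pow]; norm_num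
      have e2 : ‖Z ((A ^ k) v)‖ ≤ ‖Z‖ * (C' * (2 / 3) ^ k) :=
        (Z.le_opNorm _).trans (mul_le_mul_of_nonneg_left (hC' k) (norm_nonneg _))
      have e3 := (hgrow k).trans e2
      rw [e1] at e3
      have e4 : (0 : ℝ) < (2 / 3) ^ k := by positivity
      nlinarith [mul_lt_mul_of_pos_right hk e4]
  · intro v
    exact congrArg (fun f : V →L[ℂ] V => f v) h3
  · exact hlow
  · intro v
    exact (φ A - φ P * φ A * Z).le_of_opNorm_le h7 v

variable {V : Type*} [AddCommGroup V] [Module ℂ V]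

/-- The vectors whose orbit under `A` decays at least like `(2 / 3) ^ k`. The base `2 / 3` lies
between the decay rate `5 / 9` on the kernel and the growth rate `5 / 6` on the range of the
projections in `exists_perturbed_projection`. -/
def slowSubmodule (N : Seminorm ℂ V) (A : Module.End ℂ V) : Submodule ℂ V where
  carrier := {v | ∃ C : ℝ, ∀ k : ℕ, N ((A ^ k) v) ≤ C * (2 / 3) ^ k}
  zero_mem' := ⟨0, fun k => by simp⟩
  add_mem' := by
    rintro v w ⟨C, hC⟩ ⟨C', hC'⟩
    refine ⟨C + C', fun k => ?_⟩
    rw [map_add, add_mul]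
    exact (map_add_le_add N _ _).trans (add_le_add (hC k) (hC' k))
  smul_mem' := by
    rintro c v ⟨C, hC⟩
    refine ⟨‖c‖ * C, fun k => ?_⟩
    rw [map_smul, map_smul_eq_mul, mul_assoc]
    exact mul_le_mul_of_nonneg_left (hC k) (norm_nonneg _)

/-- `exists_dominant_projection_of_norm` for a definite seminorm on a space that carries no
topology. -/
theorem exists_dominant_projection [FiniteDimensional ℂ V] (N : Seminorm ℂ V)
    (hN : ∀ v, N v = 0 → v = 0) {P A : Module.End ℂ V} (hP : P * P = P)
    (hP1 : ∀ v, N (P v) ≤ N v) {x : ℝ} (hx : 0 < x) (hx9 : x ≤ 1 / 9)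
    (hE : ∀ v, N (A v - P v) ≤ x * N v) :
    ∃ Z : Module.End ℂ V, Z * P = P ∧ P * Z = Z ∧ LinearMap.ker Z = slowSubmodule N A ∧
      (∀ v, Z (A v) = Z (A (Z v))) ∧ (∀ v, 5 / 6 * N (Z v) ≤ N (Z (A v))) ∧
      ∀ v, N (A v - P (A (Z v))) ≤ errorBound x * N v := by
  let _ : Norm V := ⟨N⟩
  have core : NormedSpace.Core ℂ V :=
    { norm_nonneg := fun v => apply_nonneg N v
      norm_smul := fun c v => map_smul_eq_mul N c v
      norm_triangle := fun v w => map_add_le_add N v w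
      norm_eq_zero_iff := fun v => ⟨hN v, fun h => by rw [h]; exact map_zero N⟩ }
  let _ : NormedAddCommGroup V := NormedAddCommGroup.ofCore core
  let _ : NormedSpace ℂ V := NormedSpace.ofCore core
  obtain ⟨Z, h1, h2, h3, h4⟩ := exists_dominant_projection_of_norm hP hP1 hx hx9 hE
  exact ⟨Z, h1, h2, Submodule.ext h3, h4⟩

theorem map_mem_slowSubmodule [FiniteDimensional ℂ V] {N : Seminorm ℂ V}
    {A T : Module.End ℂ V} (hcomm : Commute T A)
    {C₀ : ℝ} (hC₀ : ∀ v, N (T v) ≤ C₀ * N v) {v : V}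
    (hv : v ∈ slowSubmodule N A) : T v ∈ slowSubmodule N A := by
  obtain ⟨C, hC⟩ := hv
  refine ⟨|C₀| * C, fun k => ?_⟩
  have e : (A ^ k) (T v) = T ((A ^ k) v) := by
    rw [← Module.End.mul_apply, ← Module.End.mul_apply, (hcomm.pow_right k).eq]
  rw [e, mul_assoc]
  calc N (T ((A ^ k) v)) ≤ C₀ * N ((A ^ k) v) := hC₀ _
    _ ≤ |C₀| * N ((A ^ k) v) := by gcongr; exact le_abs_self _
    _ ≤ _ := mul_le_mul_of_nonneg_left (hC k) (abs_nonneg _)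

/-- The dominant invariant subspace of `T` with threshold `r`. -/
def dominantSubspace (T : Module.End ℂ V) (r : ℝ) : Submodule ℂ V :=
  ⨆ μ : {μ : ℂ // r < ‖μ‖}, T.maxGenEigenspace (μ : ℂ)

/-- The slow vectors of `T ^ m` are the sum of the generalized eigenspaces of `T` with eigenvalues
of absolute value at most `r`, where `r ^ m = 2 / 3`. -/
theorem isCompl_dominantSubspace_slowSubmodule [FiniteDimensional ℂ V] {N : Seminorm ℂ V}
    (hN : ∀ v, N v = 0 → v = 0) {T Z : Module.End ℂ V} {m : ℕ}
    (hNT : ∀ v, N (T v) ≤ N v) {r : ℝ} (hr : 0 ≤ r) (hrm : r ^ m = 2 / 3)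
    (hker : LinearMap.ker Z = slowSubmodule N (T ^ m))
    (hinv : ∀ v, Z ((T ^ m) v) = Z ((T ^ m) (Z v)))
    (hlow : ∀ v, 5 / 6 * N (Z v) ≤ N (Z ((T ^ m) v))) :
    IsCompl (dominantSubspace T r) (slowSubmodule N (T ^ m)) := by
  set W := slowSubmodule N (T ^ m) with hW
  have hTW : ∀ v ∈ W, T v ∈ W := fun v hv =>
    map_mem_slowSubmodule (Commute.self_pow T m) (C₀ := 1) (by simpa using hNT) hv
  have hsub : ∀ (μ : ℂ) v, v ∈ W → (T - μ • (1 : Module.End ℂ V)) v ∈ W := fun μ v hv =>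
    W.sub_mem (hTW v hv) (W.smul_mem μ hv)
  have hpow : ∀ (μ : ℂ) v, (T - μ • (1 : Module.End ℂ V)) v ∈ W → ∀ j : ℕ,
      (T ^ j) v - μ ^ j • v ∈ W := by
    intro μ v hv j
    induction j with
    | zero => simp
    | succ j ih =>
      have e : (T ^ (j + 1)) v - μ ^ (j + 1) • v
          = T ((T ^ j) v - μ ^ j • v) + μ ^ j • ((T - μ • (1 : Module.End ℂ V)) v) := by
        simp only [pow_succ' T, pow_succ μ, Module.End.mul_apply, map_sub, map_smul,
          LinearMap.sub_apply, LinearMap.smul_apply, Module.End.one_apply, smul_sub, smul_smul]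
        abel
      rw [e]
      exact W.add_mem (hTW _ ih) (W.smul_mem _ hv)
  -- Modulo `W = ker Z` a generalized eigenvector for `μ` becomes an eigenvector, on which `T ^ m`
  -- acts by `μ ^ m`; this is too small for the lower bound `hlow`.
  have hsmall : ∀ μ : ℂ, ‖μ‖ ≤ r → T.maxGenEigenspace μ ≤ W := by
    intro μ hμ v hv
    obtain ⟨k, hk⟩ := (Module.End.mem_maxGenEigenspace T μ v).1 hv
    clear hv
    induction k generalizing v with
    | zero => rw [pow_zero, Module.End.one_apply] at hk; rw [hk]; exact W.zero_mem
    | succ k ih =>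
      rw [pow_succ, Module.End.mul_apply] at hk
      have h := hpow μ v (ih hk) m
      rw [← hker, LinearMap.mem_ker, map_sub, map_smul, sub_eq_zero] at h
      have h1 := hlow v
      rw [h, map_smul_eq_mul, norm_pow] at h1
      have h2 : ‖μ‖ ^ m ≤ 2 / 3 := hrm ▸ pow_le_pow_left₀ (norm_nonneg _) hμ m
      have h3 : N (Z v) = 0 := by nlinarith [apply_nonneg N (Z v)]
      rw [← hker, LinearMap.mem_ker]
      exact hN _ h3
  -- An eigenvector in `W` with a large eigenvalue would not decay.
  have hbig : ∀ μ : ℂ, r < ‖μ‖ → W ⊓ T.maxGenEigenspace μ = ⊥ := by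
    intro μ hμ
    rw [eq_bot_iff]
    rintro v ⟨hvW, hv⟩
    obtain ⟨k, hk⟩ := (Module.End.mem_maxGenEigenspace T μ v).1 hv
    clear hv
    rw [Submodule.mem_bot]
    induction k generalizing v with
    | zero => simpa using hk
    | succ k ih =>
      rw [pow_succ, Module.End.mul_apply] at hk
      have h := ih (hsub μ v hvW) hk
      have hTv : T v = μ • v := by simpa [sub_eq_zero] using h
      have hpowv : ∀ j : ℕ, (T ^ j) v = μ ^ j • v := by
        intro j
        induction j with
        | zero => simp
        | succ j ihj =>
          rw [pow_succ, Module.End.mul_apply, hTv, map_smul, ihj, smul_smul, pow_succ']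
      obtain ⟨C, hC⟩ := hvW
      by_contra hne
      have hNv : 0 < N v := (apply_nonneg N v).lt_of_ne fun h0 => hne (hN v h0.symm)
      have hm : m ≠ 0 := by rintro rfl; norm_num at hrm
      have hμm : 2 / 3 < ‖μ‖ ^ m := hrm ▸ pow_lt_pow_left₀ hμ hr hm
      obtain ⟨j, hj⟩ := pow_unbounded_of_one_lt (C / N v)
        (show (1 : ℝ) < ‖μ‖ ^ m / (2 / 3) by rw [lt_div_iff₀ (by norm_num)]; linarith)
      have := hC j
      rw [← pow_mul, hpowv, map_smul_eq_mul, norm_pow, pow_mul] at this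
      rw [div_lt_iff₀ hNv, div_pow, div_mul_eq_mul_div, lt_div_iff₀ (by positivity)] at hj
      linarith
  set S : Submodule ℂ V := ⨆ μ ∈ {μ : ℂ | ‖μ‖ ≤ r}, T.maxGenEigenspace μ with hS
  have hWS : W = S := by
    apply le_antisymm
    · rw [Submodule.eq_iSup_inf_genEigenspace ⊤ hTW (Module.End.iSup_maxGenEigenspace_eq_top T)]
      refine iSup_le fun μ => ?_
      by_cases h : ‖μ‖ ≤ r
      · exact inf_le_right.trans (le_biSup (fun μ => T.maxGenEigenspace μ) h)
      · exact (hbig μ (not_le.1 h)).le.trans bot_le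
    · exact iSup₂_le hsmall
  have hU : dominantSubspace T r = ⨆ μ ∈ {μ : ℂ | r < ‖μ‖}, T.maxGenEigenspace μ :=
    iSup_subtype
  rw [hWS, hU]
  constructor
  · refine (Module.End.independent_maxGenEigenspace T).disjoint_biSup_biSup ?_
    rw [Set.disjoint_left]
    intro μ h1 h2
    exact absurd (show r < ‖μ‖ from h1) (not_lt.2 h2)
  · rw [codisjoint_iff, eq_top_iff, ← Module.End.iSup_maxGenEigenspace_eq_top T]
    refine iSup_le fun μ => ?_
    rcases lt_or_ge r ‖μ‖ with h | h
    · exact (le_biSup (fun μ => T.maxGenEigenspace μ) h).trans le_sup_left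
    · exact (le_biSup (fun μ => T.maxGenEigenspace μ) h).trans le_sup_right

theorem dominantSubspace_antitone (T : Module.End ℂ V) : Antitone (dominantSubspace T) :=
  fun _ _ h => iSup_le fun μ => le_iSup_of_le ⟨μ, h.trans_lt μ.2⟩ le_rfl

/-- The dominant invariant subspaces form a chain, so they are determined by their dimension. -/
theorem IsDominantInvariantSubspace.eq_of_finrank_eq [FiniteDimensional ℂ V]
    {T : Module.End ℂ V} {U U' : Submodule ℂ V} (hU : IsDominantInvariantSubspace T U)
    (hU' : IsDominantInvariantSubspace T U') (h : Module.finrank ℂ U = Module.finrank ℂ U') :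
    U = U' := by
  obtain ⟨r, rfl⟩ := hU
  obtain ⟨r', rfl⟩ := hU'
  rcases le_total r r' with hr | hr
  · exact (Submodule.eq_of_le_of_finrank_eq (dominantSubspace_antitone T hr) h.symm).symm
  · exact Submodule.eq_of_le_of_finrank_eq (dominantSubspace_antitone T hr) h

theorem finrank_eq_finrank_range [FiniteDimensional ℂ V] {P Z : Module.End ℂ V}
    (h1 : Z * P = P) (h2 : P * Z = Z) {U : Submodule ℂ V} (hU : IsCompl U (LinearMap.ker Z)) :
    Module.finrank ℂ U = Module.finrank ℂ (LinearMap.range P) := by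
  have e : LinearMap.range P = LinearMap.range Z := by
    apply le_antisymm
    · rw [← h1]; exact LinearMap.range_comp_le_range _ _
    · rw [← h2]; exact LinearMap.range_comp_le_range _ _
  have a := Submodule.finrank_add_eq_of_isCompl hU
  have b := LinearMap.finrank_range_add_finrank_ker Z
  rw [e]; omega

/-! ### Convolution operators on super-operator valued functions -/

section Convolution

variable {G : Type*} [Group G] [Fintype G] {d : ℕ}

/-- The norm `∑ h, ‖F h‖₁` on functions from the group to operators. -/
noncomputable def l1Seminorm (G : Type*) [Fintype G] (d : ℕ) : Seminorm ℂ (G → Op d) :=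
  Seminorm.of (fun F => ∑ h, traceNorm (F h))
    (fun F F' => by
      rw [← Finset.sum_add_distrib]
      exact Finset.sum_le_sum fun h _ => traceNorm_add_le _ _)
    (fun c F => by
      rw [Finset.mul_sum]
      exact Finset.sum_congr rfl fun h _ => map_smul_eq_mul (traceSeminorm (Fin d)) c (F h))

omit [Group G] in
theorem l1Seminorm_apply (F : G → Op d) : l1Seminorm G d F = ∑ h, traceNorm (F h) := rfl

omit [Group G] in
theorem eq_zero_of_l1Seminorm_eq_zero {F : G → Op d} (hF : l1Seminorm G d F = 0) : F = 0 := by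
  rw [l1Seminorm_apply, Finset.sum_eq_zero_iff_of_nonneg fun h _ => traceNorm_nonneg _] at hF
  exact funext fun h => eq_zero_of_traceNorm_eq_zero (hF h (Finset.mem_univ h))

/-- Left convolution by a super-operator valued function: `(ψ * F)(h) = ∑ g, ψ g (F (g⁻¹ h))`. -/
def convOp (ψ : G → SuperOp d) : Module.End ℂ (G → Op d) where
  toFun F h := ∑ g, ψ g (F (g⁻¹ * h))
  map_add' F F' := by
    ext1 h
    simp only [Pi.add_apply, map_add, Finset.sum_add_distrib]
  map_smul' c F := by
    ext1 h
    simp only [Pi.smul_apply, map_smul, Finset.smul_sum, RingHom.id_apply]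

theorem convOp_apply (ψ : G → SuperOp d) (F : G → Op d) (h : G) :
    convOp ψ F h = ∑ g, ψ g (F (g⁻¹ * h)) := rfl

theorem convOp_sub (ψ χ : G → SuperOp d) : convOp (ψ - χ) = convOp ψ - convOp χ := by
  ext1 F
  funext h
  simp only [convOp_apply, LinearMap.sub_apply, Pi.sub_apply, Finset.sum_sub_distrib]

theorem l1Seminorm_convOp_le {ψ : G → SuperOp d} {B : G → ℝ}
    (hB : ∀ g X, traceNorm (ψ g X) ≤ B g * traceNorm X) (F : G → Op d) :
    l1Seminorm G d (convOp ψ F) ≤ (∑ g, B g) * l1Seminorm G d F := by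
  calc l1Seminorm G d (convOp ψ F)
      ≤ ∑ h, ∑ g, B g * traceNorm (F (g⁻¹ * h)) := by
        refine Finset.sum_le_sum fun h _ => ?_
        exact (seminorm_sum_le (traceSeminorm (Fin d)) _ _).trans
          (Finset.sum_le_sum fun g _ => hB g _)
    _ = ∑ g, B g * l1Seminorm G d F := by
        rw [Finset.sum_comm]
        refine Finset.sum_congr rfl fun g _ => ?_
        rw [← Finset.mul_sum]
        congr 1
        exact Fintype.sum_equiv (Equiv.mulLeft g⁻¹) _ _ fun h => rfl
    _ = _ := by rw [Finset.sum_mul]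

theorem traceNorm_ofReal_smul (a : ℝ) (X : Op d) :
    traceNorm ((a : ℂ) • X) = |a| * traceNorm X := by
  have := map_smul_eq_mul (traceSeminorm (Fin d)) (a : ℂ) X
  rwa [Complex.norm_real] at this

/-- The function `g ↦ f g • φ g`. -/
def scaled (f : G → ℝ) (φ : G → SuperOp d) : G → SuperOp d := fun g => (f g : ℂ) • φ g

theorem l1Seminorm_convOp_scaled_le {f : G → ℝ} {φ : G → SuperOp d}
    (hφ : ∀ g X, traceNorm (φ g X) ≤ traceNorm X) (F : G → Op d) :
    l1Seminorm G d (convOp (scaled f φ) F) ≤ (∑ g, |f g|) * l1Seminorm G d F :=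
  l1Seminorm_convOp_le (fun g X => by
    rw [scaled, LinearMap.smul_apply, traceNorm_ofReal_smul]
    exact mul_le_mul_of_nonneg_left (hφ g X) (abs_nonneg _)) F

theorem convOp_scaled_mul (ω : Representation ℂ G (Op d)) (f f' : G → ℝ) :
    convOp (scaled f ω) * convOp (scaled f' ω) = convOp (scaled (conv f f') ω) := by
  ext1 F
  funext h
  rw [Module.End.mul_apply]
  simp only [convOp_apply, scaled, LinearMap.smul_apply, map_sum, map_smul,
    smul_smul, conv, Complex.ofReal_sum, Finset.sum_smul, LinearMap.sum_apply]
  rw [Finset.sum_comm]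
  conv_rhs => rw [Finset.sum_comm]
  refine Finset.sum_congr rfl fun k _ => ?_
  refine Fintype.sum_equiv (Equiv.mulRight k) _ _ fun g => ?_
  simp only [Equiv.coe_mulRight, mul_inv_cancel_right, mul_inv_rev, map_mul, Module.End.mul_apply,
    Complex.ofReal_mul]
  rw [mul_comm (f' k : ℂ), mul_assoc k⁻¹]

/-- For a representation, powers of the convolution operator correspond to convolution powers of the
weight. -/
theorem convOp_scaled_pow (ω : Representation ℂ G (Op d)) (f : G → ℝ) (m : ℕ) :
    convOp (scaled f ω) ^ m = convOp (scaled (convPow f m) ω) := by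
  classical
  induction m with
  | zero =>
    refine LinearMap.ext fun F => funext fun h => ?_
    rw [convOp_apply, Finset.sum_eq_single 1]
    · simp [scaled, convPow]
    · intro g _ hg; simp [scaled, convPow, hg]
    · simp
  | succ m ih => rw [pow_succ', ih, convOp_scaled_mul]; rfl

/-- Convolution by `ω` with the uniform distribution; it projects onto the functions
`h ↦ ω h X`. -/
noncomputable def averaging (ω : Representation ℂ G (Op d)) : Module.End ℂ (G → Op d) :=
  convOp (scaled (fun _ => 1 / (Fintype.card G : ℝ)) ω)

theorem averaging_mul_self (ω : Representation ℂ G (Op d)) :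
    averaging ω * averaging ω = averaging ω := by
  rw [averaging, convOp_scaled_mul]
  congr 2
  funext g
  simp [conv]

theorem averaging_apply (ω : Representation ℂ G (Op d)) (F : G → Op d) (h : G) :
    averaging ω F h = ω h (∑ k, ((1 / (Fintype.card G : ℝ) : ℝ) : ℂ) • ω k⁻¹ (F k)) := by
  rw [averaging, convOp_apply, map_sum]
  refine Fintype.sum_equiv ((Equiv.inv G).trans (Equiv.mulRight h)) _ _ fun g => ?_
  simp only [scaled, Equiv.trans_apply, Equiv.inv_apply, Equiv.coe_mulRight, map_smul,
    LinearMap.smul_apply]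
  rw [← Module.End.mul_apply, ← map_mul]
  simp

theorem seminorm_pow_sub_pow_le {V : Type*} [AddCommGroup V] [Module ℂ V] (N : Seminorm ℂ V)
    {S T : Module.End ℂ V} (hS : ∀ v, N (S v) ≤ N v) (hT : ∀ v, N (T v) ≤ N v) {η : ℝ}
    (hη : ∀ v, N (S v - T v) ≤ η * N v) (m : ℕ) (v : V) :
    N ((S ^ m) v - (T ^ m) v) ≤ m * η * N v := by
  induction m generalizing v with
  | zero => simp
  | succ m ih =>
    have hSm : ∀ (k : ℕ) v, N ((S ^ k) v) ≤ N v := by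
      intro k
      induction k with
      | zero => simp
      | succ k ih =>
        intro v
        rw [pow_succ', Module.End.mul_apply]
        exact (hS _).trans (ih v)
    have e : (S ^ (m + 1)) v - (T ^ (m + 1)) v
        = (S ^ m) (S v - T v) + ((S ^ m) (T v) - (T ^ m) (T v)) := by
      rw [pow_succ, pow_succ, Module.End.mul_apply, Module.End.mul_apply, map_sub]
      abel
    have hη0 : 0 ≤ η * N v := (apply_nonneg _ _).trans (hη v)
    rw [e]
    refine (map_add_le_add N _ _).trans ?_
    have h1 := (hSm m (S v - T v)).trans (hη v)
    have h2 : N ((S ^ m) (T v) - (T ^ m) (T v)) ≤ m * η * N v := by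
      rcases le_or_gt 0 η with h | h
      · exact (ih (T v)).trans (mul_le_mul_of_nonneg_left (hT v) (by positivity))
      · have : N v = 0 := by nlinarith [apply_nonneg N v]
        have h3 : N (T v) = 0 := le_antisymm (this ▸ hT v) (apply_nonneg _ _)
        simpa [this, h3] using ih (T v)
    push_cast
    linarith

variable {ω : Representation ℂ G (Op d)} {φ : G → SuperOp d} {ν : G → ℝ}

theorem l1Seminorm_averaging_le (hω : ∀ g X, traceNorm (ω g X) ≤ traceNorm X) (F : G → Op d) :
    l1Seminorm G d (averaging ω F) ≤ l1Seminorm G d F := by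
  have h1 : ∑ _g : G, |1 / (Fintype.card G : ℝ)| = 1 := by simp
  have h2 := l1Seminorm_convOp_scaled_le (f := fun _ => 1 / (Fintype.card G : ℝ)) hω F
  rwa [h1, one_mul] at h2

omit [Group G] in
theorem IsProbDist.sum_abs (hν : IsProbDist ν) : ∑ g, |ν g| = 1 := by
  rw [← hν.sum_eq_one]
  exact Finset.sum_congr rfl fun g _ => abs_of_nonneg (hν.nonneg g)

theorem IsProbDist.l1Seminorm_convOp_le (hν : IsProbDist ν)
    (hφ : ∀ g X, traceNorm (φ g X) ≤ traceNorm X) (F : G → Op d) :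
    l1Seminorm G d (convOp (scaled ν φ) F) ≤ l1Seminorm G d F := by
  have := l1Seminorm_convOp_scaled_le (f := ν) hφ F
  rwa [hν.sum_abs, one_mul] at this

/-- Telescoping costs `m · (δ / m)`; what remains is the distance of the `m`-fold convolution power
from the uniform distribution. -/
theorem l1Seminorm_convOp_pow_sub_averaging_le
    (hω : ∀ g X, traceNorm (ω g X) ≤ traceNorm X) (hφ : ∀ g X, traceNorm (φ g X) ≤ traceNorm X)
    (hν : IsProbDist ν) {m : ℕ} (hm : 0 < m) {δ δ' : ℝ}
    (hmix : ∑ g, |convPow ν m g - 1 / (Fintype.card G : ℝ)| ≤ δ')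
    (hclose : ∑ g, ν g * diamondNorm (ω g - φ g) ≤ δ / m) (F : G → Op d) :
    l1Seminorm G d ((convOp (scaled ν φ) ^ m) F - averaging ω F)
      ≤ (δ + δ') * l1Seminorm G d F := by
  have hclose' : ∀ F : G → Op d, l1Seminorm G d (convOp (scaled ν ω) F - convOp (scaled ν φ) F)
      ≤ δ / m * l1Seminorm G d F := by
    intro F
    rw [← LinearMap.sub_apply, ← convOp_sub]
    refine (l1Seminorm_convOp_le (B := fun g => ν g * diamondNorm (ω g - φ g))
      (fun g X => ?_) F).trans (mul_le_mul_of_nonneg_right hclose (apply_nonneg _ _))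
    have e : (scaled ν ω - scaled ν φ) g X = (ν g : ℂ) • (ω g - φ g) X := by
      simp [scaled, smul_sub]
    rw [e, traceNorm_ofReal_smul, abs_of_nonneg (hν.nonneg g), mul_assoc]
    exact mul_le_mul_of_nonneg_left (traceNorm_map_le_diamondNorm _ _) (hν.nonneg g)
  have h1 := seminorm_pow_sub_pow_le (l1Seminorm G d) (hν.l1Seminorm_convOp_le hω)
    (hν.l1Seminorm_convOp_le hφ) hclose' m F
  rw [mul_div_cancel₀ _ (by positivity : (m : ℝ) ≠ 0), map_sub_rev] at h1
  have h2 : l1Seminorm G d ((convOp (scaled ν ω) ^ m) F - averaging ω F)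
      ≤ δ' * l1Seminorm G d F := by
    have e : (convOp (scaled ν ω) ^ m) F - averaging ω F
        = convOp (scaled (fun g => convPow ν m g - 1 / (Fintype.card G : ℝ)) ω) F := by
      rw [convOp_scaled_pow, averaging, ← LinearMap.sub_apply, ← convOp_sub]
      congr 2
      funext g
      change (_ : ℂ) • ω g - (_ : ℂ) • ω g = (_ : ℂ) • ω g
      rw [Complex.ofReal_sub]
      exact (sub_smul _ _ _).symm
    rw [e]
    exact (l1Seminorm_convOp_scaled_le hω F).trans
      (mul_le_mul_of_nonneg_right hmix (apply_nonneg _ _))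
  calc _ = l1Seminorm G d (((convOp (scaled ν φ) ^ m) F - (convOp (scaled ν ω) ^ m) F)
        + ((convOp (scaled ν ω) ^ m) F - averaging ω F)) := by rw [sub_add_sub_cancel]
    _ ≤ _ := (map_add_le_add _ _ _).trans (by rw [add_mul]; exact add_le_add h1 h2)

open Classical in
theorem convOp_single (ψ : G → SuperOp d) (k : G) (X : Op d) :
    convOp ψ (Pi.single k X) = ∑ g, Pi.single (g * k) (ψ g X) := by
  funext h
  rw [convOp_apply, Finset.sum_apply]
  refine Finset.sum_congr rfl fun g _ => ?_
  by_cases hg : g⁻¹ * h = k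
  · subst hg; simp
  · have : h ≠ g * k := by rintro rfl; simp at hg
    rw [Pi.single_eq_of_ne hg, Pi.single_eq_of_ne this, map_zero]

omit [Group G] [Fintype G] in
theorem orderedProd_snoc {A : Type*} [Monoid A] {m : ℕ} (x : G → A) (g : Fin m → G) (a : G) :
    orderedProd x (Fin.snoc g a : Fin (m + 1) → G) = x a * orderedProd x g := by
  rw [orderedProd, List.ofFn_succ', List.concat_eq_append, List.reverse_append]
  simp [orderedProd]

open Classical in
/-- Expansion of `T ^ m F₀` into gate sequences. -/
theorem convOp_scaled_pow_single (ν : G → ℝ) (φ : G → SuperOp d) (X : Op d) (m : ℕ) :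
    (convOp (scaled ν φ) ^ m) (Pi.single 1 X)
      = ∑ g : Fin m → G, ((∏ j, ν (g j) : ℝ) : ℂ) •
          Pi.single (orderedProd id g) (orderedProd φ g X) := by
  induction m with
  | zero => simp [orderedProd]
  | succ m ih =>
    rw [pow_succ', Module.End.mul_apply, ih, map_sum]
    rw [← (Fin.snocEquiv fun _ : Fin (m + 1) => G).sum_comp, Fintype.sum_prod_type,
      Finset.sum_comm]
    refine Finset.sum_congr rfl fun g _ => ?_
    rw [map_smul, convOp_single, Finset.smul_sum]
    refine Finset.sum_congr rfl fun a _ => ?_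
    change _ = ((∏ j, ν ((Fin.snoc g a : Fin (m + 1) → G) j) : ℝ) : ℂ) •
      (Pi.single (orderedProd id (Fin.snoc g a : Fin (m + 1) → G))
        (orderedProd φ (Fin.snoc g a : Fin (m + 1) → G) X) : G → Op d)
    rw [orderedProd_snoc, orderedProd_snoc, Fin.prod_univ_castSucc]
    simp only [Fin.snoc_castSucc, Fin.snoc_last, id, Module.End.mul_apply, scaled,
      LinearMap.smul_apply, Pi.single_smul, smul_smul, Complex.ofReal_mul]

/-- The readout: apply the ending gate that belongs to each product `h` of gates, then the noisy
measurement. -/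
def readout (φ : G → SuperOp d) (gEnd : G) (meas : SuperOp d) (E : Op d) :
    (G → Op d) →ₗ[ℂ] ℂ :=
  ∑ h, Matrix.traceLinearMap (Fin d) ℂ ℂ ∘ₗ LinearMap.mulLeft ℂ E ∘ₗ meas ∘ₗ φ (gEnd * h⁻¹) ∘ₗ
    LinearMap.proj h

theorem readout_apply (φ : G → SuperOp d) (gEnd : G) (meas : SuperOp d) (E : Op d) (F : G → Op d) :
    readout φ gEnd meas E F = ∑ h, (E * meas (φ (gEnd * h⁻¹) (F h))).trace := by
  simp [readout, LinearMap.sum_apply]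

open Classical in
theorem outputProb_eq_readout (ν : G → ℝ) (φ : G → SuperOp d) (gEnd : G) (prep meas : SuperOp d)
    (ρ₀ E : Op d) (m : ℕ) :
    outputProb ν φ gEnd prep meas ρ₀ E m
      = readout φ gEnd meas E ((convOp (scaled ν φ) ^ m) (Pi.single 1 (prep ρ₀))) := by
  rw [convOp_scaled_pow_single, map_sum, outputProb]
  refine Finset.sum_congr rfl fun g _ => ?_
  rw [map_smul, smul_eq_mul, readout_apply, Finset.sum_eq_single (orderedProd id g)]
  · rw [Pi.single_eq_same]
  · intro h _ hh
    rw [Pi.single_eq_of_ne hh]; simp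
  · simp

theorem norm_readout_le (hφ : ∀ g X, traceNorm (φ g X) ≤ traceNorm X) (gEnd : G)
    {meas : SuperOp d} (hmeas : ∀ X, traceNorm (meas X) ≤ traceNorm X) {E : Op d}
    (hE : E.PosSemidef) (hE1 : (1 - E).PosSemidef) (F : G → Op d) :
    ‖readout φ gEnd meas E F‖ ≤ l1Seminorm G d F := by
  rw [readout_apply]
  refine (norm_sum_le _ _).trans (Finset.sum_le_sum fun h _ => ?_)
  exact (norm_trace_effect_mul_le hE hE1 _).trans ((hmeas _).trans (hφ _ _))

end Convolution

/-! ### Fourier modes -/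

section Fourier

variable {G : Type*} [Group G] [Fintype G] {d k : ℕ}

/-- The Fourier transform without the factor `|G|⁻¹`: `∑ g, conj (σ g) ⊗ ψ g`. -/
noncomputable def fourierSum (σ : G →* Matrix.unitaryGroup (Fin k) ℂ) (ψ : G → SuperOp d) :
    Module.End ℂ ((Fin k → ℂ) ⊗[ℂ] Op d) :=
  ∑ g, TensorProduct.map
    (Matrix.toLin' ((σ g : Matrix (Fin k) (Fin k) ℂ).map (starRingEnd ℂ))) (ψ g)

theorem fourier_weighted (σ : G →* Matrix.unitaryGroup (Fin k) ℂ) (ν : G → ℝ)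
    (φ : G → SuperOp d) : fourier (weighted ν φ) σ = fourierSum σ (scaled ν φ) := by
  rw [fourier, fourierSum, Finset.smul_sum]
  refine Finset.sum_congr rfl fun g _ => ?_
  rw [← TensorProduct.map_smul_right]
  congr 1
  change _ • (_ : ℂ) • φ g = (_ : ℂ) • φ g
  rw [smul_smul, Complex.ofReal_mul, Complex.ofReal_natCast, inv_mul_cancel_left₀]
  exact_mod_cast Fintype.card_ne_zero

/-- The map `c ⊗ X ↦ (h ↦ (c ᵥ* σ h) u • X)` to functions on the group, given by the matrix
coefficients of `σ` in column `u`. -/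
noncomputable def coeffMap (d : ℕ) (σ : G →* Matrix.unitaryGroup (Fin k) ℂ) (u : Fin k) :
    ((Fin k → ℂ) ⊗[ℂ] Op d) →ₗ[ℂ] (G → Op d) :=
  LinearMap.pi fun h => (TensorProduct.lid ℂ (Op d)).toLinearMap ∘ₗ
    TensorProduct.map (LinearMap.proj u ∘ₗ (σ h : Matrix (Fin k) (Fin k) ℂ).vecMulLinear)
      LinearMap.id

omit [Fintype G] in
theorem coeffMap_tmul (σ : G →* Matrix.unitaryGroup (Fin k) ℂ) (u : Fin k) (c : Fin k → ℂ)
    (X : Op d) (h : G) : coeffMap d σ u (c ⊗ₜ X) h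
      = Matrix.vecMul c (σ h : Matrix (Fin k) (Fin k) ℂ) u • X := by
  simp [coeffMap]

omit [Fintype G] in
/-- Since `σ g` is unitary, multiplying a row vector by `(σ g)⁻¹` amounts to multiplying the column
vector by the complex conjugate of `σ g`. -/
theorem vecMul_inv_mul (σ : G →* Matrix.unitaryGroup (Fin k) ℂ) (c : Fin k → ℂ) (g h : G) :
    Matrix.vecMul c (σ (g⁻¹ * h) : Matrix (Fin k) (Fin k) ℂ)
      = Matrix.vecMul (Matrix.mulVec ((σ g : Matrix (Fin k) (Fin k) ℂ).map (starRingEnd ℂ)) c)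
          (σ h : Matrix (Fin k) (Fin k) ℂ) := by
  rw [map_mul, map_inv]
  change Matrix.vecMul c (star (σ g : Matrix (Fin k) (Fin k) ℂ) * (σ h : Matrix _ _ ℂ)) = _
  rw [← Matrix.vecMul_vecMul, ← Matrix.vecMul_transpose]
  rfl

/-- The matrix coefficient maps intertwine the Fourier mode with the convolution operator. -/
theorem coeffMap_fourierSum (σ : G →* Matrix.unitaryGroup (Fin k) ℂ) (ψ : G → SuperOp d)
    (u : Fin k) (z : (Fin k → ℂ) ⊗[ℂ] Op d) :
    coeffMap d σ u (fourierSum σ ψ z) = convOp ψ (coeffMap d σ u z) := by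
  induction z with
  | zero => simp
  | add z w hz hw => rw [map_add, map_add, map_add, map_add, hz, hw]
  | tmul c X =>
    funext h
    rw [fourierSum, LinearMap.sum_apply, map_sum, Finset.sum_apply, convOp_apply]
    refine Finset.sum_congr rfl fun g _ => ?_
    rw [TensorProduct.map_tmul, coeffMap_tmul, coeffMap_tmul, map_smul, vecMul_inv_mul,
      Matrix.toLin'_apply]

theorem coeffMap_fourierSum_pow (σ : G →* Matrix.unitaryGroup (Fin k) ℂ) (ψ : G → SuperOp d)
    (u : Fin k) (m : ℕ) (z : (Fin k → ℂ) ⊗[ℂ] Op d) :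
    coeffMap d σ u ((fourierSum σ ψ ^ m) z) = (convOp ψ ^ m) (coeffMap d σ u z) := by
  induction m with
  | zero => simp
  | succ m ih =>
    rw [pow_succ', pow_succ', Module.End.mul_apply, Module.End.mul_apply, coeffMap_fourierSum, ih]

omit [Fintype G] in
theorem sum_single_tmul_coeffMap_one (σ : G →* Matrix.unitaryGroup (Fin k) ℂ)
    (z : (Fin k → ℂ) ⊗[ℂ] Op d) :
    ∑ u, (Pi.single u (1 : ℂ) : Fin k → ℂ) ⊗ₜ[ℂ] coeffMap d σ u z 1 = z := by
  induction z with
  | zero => simp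
  | add z w hz hw =>
    simp only [map_add, Pi.add_apply, TensorProduct.tmul_add, Finset.sum_add_distrib, hz, hw]
  | tmul c X =>
    simp only [coeffMap_tmul, map_one, Submonoid.coe_one, Matrix.vecMul_one,
      TensorProduct.tmul_smul, TensorProduct.smul_tmul']
    rw [← TensorProduct.sum_tmul]
    congr 1
    exact (pi_eq_sum_univ' c).symm

omit [Fintype G] in
theorem coeffMap_injective (σ : G →* Matrix.unitaryGroup (Fin k) ℂ)
    {z w : (Fin k → ℂ) ⊗[ℂ] Op d} (h : ∀ u, coeffMap d σ u z = coeffMap d σ u w) : z = w := by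
  rw [← sum_single_tmul_coeffMap_one σ z, ← sum_single_tmul_coeffMap_one σ w]
  simp only [h]

/-- The norm on the space of a Fourier mode that is induced by the matrix coefficient maps. -/
noncomputable def coeffSeminorm (d : ℕ) (σ : G →* Matrix.unitaryGroup (Fin k) ℂ) :
    Seminorm ℂ ((Fin k → ℂ) ⊗[ℂ] Op d) :=
  Seminorm.of (fun z => ∑ u, l1Seminorm G d (coeffMap d σ u z))
    (fun z w => by
      rw [← Finset.sum_add_distrib]
      refine Finset.sum_le_sum fun u _ => ?_
      rw [map_add]
      exact map_add_le_add _ _ _)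
    (fun c z => by
      rw [Finset.mul_sum]
      refine Finset.sum_congr rfl fun u _ => ?_
      rw [map_smul, map_smul_eq_mul])

theorem coeffSeminorm_apply (σ : G →* Matrix.unitaryGroup (Fin k) ℂ)
    (z : (Fin k → ℂ) ⊗[ℂ] Op d) :
    coeffSeminorm d σ z = ∑ u, l1Seminorm G d (coeffMap d σ u z) := rfl

theorem l1Seminorm_coeffMap_le (σ : G →* Matrix.unitaryGroup (Fin k) ℂ) (u : Fin k)
    (z : (Fin k → ℂ) ⊗[ℂ] Op d) : l1Seminorm G d (coeffMap d σ u z) ≤ coeffSeminorm d σ z :=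
  Finset.single_le_sum (f := fun u => l1Seminorm G d (coeffMap d σ u z))
    (fun _ _ => apply_nonneg _ _) (Finset.mem_univ u)

theorem eq_zero_of_coeffSeminorm_eq_zero (σ : G →* Matrix.unitaryGroup (Fin k) ℂ)
    {z : (Fin k → ℂ) ⊗[ℂ] Op d} (hz : coeffSeminorm d σ z = 0) : z = 0 := by
  refine coeffMap_injective σ fun u => ?_
  rw [map_zero]
  exact eq_zero_of_l1Seminorm_eq_zero
    (le_antisymm (hz ▸ l1Seminorm_coeffMap_le σ u z) (apply_nonneg _ _))

/-- Norm bounds for operators on functions carry over to the Fourier modes. -/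
theorem coeffSeminorm_le_of_l1Seminorm_le (σ : G →* Matrix.unitaryGroup (Fin k) ℂ)
    {S : Module.End ℂ (G → Op d)} {C : ℝ} (hS : ∀ F, l1Seminorm G d (S F) ≤ C * l1Seminorm G d F)
    {z w : (Fin k → ℂ) ⊗[ℂ] Op d} (hw : ∀ u, coeffMap d σ u w = S (coeffMap d σ u z)) :
    coeffSeminorm d σ w ≤ C * coeffSeminorm d σ z := by
  rw [coeffSeminorm_apply, coeffSeminorm_apply, Finset.mul_sum]
  exact Finset.sum_le_sum fun u _ => by rw [hw]; exact hS _

/-- The Fourier mode of `ω` with the uniform distribution: the projection onto the invariants of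
`conj σ ⊗ ω`. -/
noncomputable def fourierAveraging (σ : G →* Matrix.unitaryGroup (Fin k) ℂ)
    (ω : Representation ℂ G (Op d)) : Module.End ℂ ((Fin k → ℂ) ⊗[ℂ] Op d) :=
  fourierSum σ (scaled (fun _ => 1 / (Fintype.card G : ℝ)) ω)

theorem coeffMap_fourierAveraging (σ : G →* Matrix.unitaryGroup (Fin k) ℂ)
    (ω : Representation ℂ G (Op d)) (u : Fin k) (z : (Fin k → ℂ) ⊗[ℂ] Op d) :
    coeffMap d σ u (fourierAveraging σ ω z) = averaging ω (coeffMap d σ u z) :=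
  coeffMap_fourierSum _ _ _ _

theorem fourierAveraging_mul_self (σ : G →* Matrix.unitaryGroup (Fin k) ℂ)
    (ω : Representation ℂ G (Op d)) :
    fourierAveraging σ ω * fourierAveraging σ ω = fourierAveraging σ ω := by
  refine LinearMap.ext fun z => coeffMap_injective σ fun u => ?_
  rw [Module.End.mul_apply, coeffMap_fourierAveraging, coeffMap_fourierAveraging,
    ← Module.End.mul_apply, averaging_mul_self]

end Fourier

section Multiplicity

variable {G : Type*} [Group G] [Fintype G] {d : ℕ} {ω : Representation ℂ G (Op d)}
  {Λ : Type*} [Fintype Λ] {D : Λ → ℕ} {σ : ∀ l, G →* Matrix.unitaryGroup (Fin (D l)) ℂ}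
  {n : Λ → ℕ}

theorem trace_eq_finrank_range_of_mul_self {V : Type*} [AddCommGroup V] [Module ℂ V]
    [FiniteDimensional ℂ V] {P : Module.End ℂ V} (hP : P * P = P) :
    LinearMap.trace ℂ V P = Module.finrank ℂ (LinearMap.range P) :=
  (LinearMap.IsIdempotentElem.isProj_range P hP).trace

/-- The trace of a block diagonal map in which the block `M l` occurs `n l` times. -/
theorem trace_pi_pi (M : ∀ l, Matrix (Fin (D l)) (Fin (D l)) ℂ)
    (f : Module.End ℂ (∀ l, Fin (n l) → Fin (D l) → ℂ))
    (hf : ∀ v l j, f v l j = Matrix.toLin' (M l) (v l j)) :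
    LinearMap.trace ℂ _ f = ∑ l, (n l : ℂ) * (M l).trace := by
  classical
  set b := Pi.basis fun l => Pi.basis fun _ : Fin (n l) => Pi.basisFun ℂ (Fin (D l)) with hb
  rw [LinearMap.trace_eq_matrix_trace ℂ b, Matrix.trace, Fintype.sum_sigma]
  refine Finset.sum_congr rfl fun l _ => ?_
  rw [Fintype.sum_sigma]
  have : ∀ j : Fin (n l), ∑ i, Matrix.diag (LinearMap.toMatrix b b f) ⟨l, ⟨j, i⟩⟩
      = (M l).trace := by
    intro j
    refine Finset.sum_congr rfl fun i _ => ?_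
    rw [Matrix.diag_apply, LinearMap.toMatrix_apply, hb, Pi.basis_repr, Pi.basis_repr,
      Pi.basisFun_repr, hf, Pi.basis_apply, Pi.single_eq_same, Pi.basis_apply, Pi.single_eq_same,
      Pi.basisFun_apply, Matrix.toLin'_apply, Matrix.mulVec_single_one]
    rfl
  simp only [this, Finset.sum_const, Finset.card_univ, Fintype.card_fin, nsmul_eq_mul]

omit [Fintype G] in
theorem IsIrrepDecomposition.trace_eq (hdec : IsIrrepDecomposition ω σ n) (g : G) :
    LinearMap.trace ℂ _ (ω g) = ∑ l, (n l : ℂ) * (unitaryRep (σ l)).character g := by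
  obtain ⟨e, he⟩ := hdec.equiv
  rw [← LinearMap.trace_conj' (ω g) e, trace_pi_pi (fun l => (σ l g : Matrix _ _ ℂ))]
  · refine Finset.sum_congr rfl fun l _ => ?_
    rw [Representation.character]
    congr 1
    exact (Matrix.trace_toLin'_eq _).symm
  · intro v l j
    rw [LinearEquiv.conj_apply_apply, he, e.apply_symm_apply]
    rfl

omit [Fintype G] in
theorem trace_toLin'_map_conj {k : ℕ} (σ : G →* Matrix.unitaryGroup (Fin k) ℂ) (g : G) :
    LinearMap.trace ℂ _ (Matrix.toLin' ((σ g : Matrix (Fin k) (Fin k) ℂ).map (starRingEnd ℂ)))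
      = (unitaryRep σ).character g⁻¹ := by
  have h : (unitaryRep σ).character g⁻¹
      = (Matrix.conjTranspose (σ g : Matrix (Fin k) (Fin k) ℂ)).trace := by
    rw [Representation.character]
    change LinearMap.trace ℂ _ (Matrix.toLin' (σ g⁻¹ : Matrix (Fin k) (Fin k) ℂ)) = _
    rw [Matrix.trace_toLin'_eq, map_inv]
    rfl
  rw [h, Matrix.trace_toLin'_eq, Matrix.conjTranspose, ← Matrix.trace_transpose]
  rfl

/-- The trace of this projection is the inner product of the characters of `ω` and `σ l`. -/
theorem IsIrrepDecomposition.finrank_range_fourierAveraging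
    (hdec : IsIrrepDecomposition ω σ n) (l : Λ) :
    Module.finrank ℂ (LinearMap.range (fourierAveraging (σ l) ω)) = n l := by
  have hG : (Nat.card G : ℂ) ≠ 0 := by exact_mod_cast Nat.card_pos.ne'
  have : Invertible (Nat.card G : ℂ) := invertibleOfNonzero hG
  have h1 := trace_eq_finrank_range_of_mul_self (fourierAveraging_mul_self (σ l) ω)
  have h2 : LinearMap.trace ℂ _ (fourierAveraging (σ l) ω) = n l := by
    calc LinearMap.trace ℂ _ (fourierAveraging (σ l) ω)
        = ∑ g, (unitaryRep (σ l)).character g⁻¹ * ((Nat.card G : ℂ)⁻¹ *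
            ∑ l', (n l' : ℂ) * (unitaryRep (σ l')).character g) := by
          rw [fourierAveraging, fourierSum, map_sum]
          refine Finset.sum_congr rfl fun g _ => ?_
          rw [LinearMap.trace_tensorProduct', trace_toLin'_map_conj, scaled, map_smul,
            hdec.trace_eq, smul_eq_mul, Nat.card_eq_fintype_card, one_div]
          push_cast
          rfl
      _ = ∑ l', (n l' : ℂ) * ((Nat.card G : ℂ)⁻¹ *
            ∑ g, (unitaryRep (σ l')).character g * (unitaryRep (σ l)).character g⁻¹) := by
          simp only [Finset.mul_sum]
          rw [Finset.sum_comm]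
          refine Finset.sum_congr rfl fun l' _ => Finset.sum_congr rfl fun g _ => by ring
      _ = n l := by
          rw [Finset.sum_eq_single l]
          · have := hdec.irreducible l
            rw [Representation.char_orthonormal, if_pos ⟨Representation.Equiv.refl _⟩, mul_one]
          · intro l' _ hl
            have := hdec.irreducible l
            have := hdec.irreducible l'
            rw [Representation.char_orthonormal, if_neg, mul_zero]
            exact not_nonempty_iff.2 (hdec.inequivalent l l' hl.symm)
          · simp
  rw [h2] at h1
  exact_mod_cast h1.symm

/-- The functions `h ↦ ω h X` are combinations of matrix coefficients of the `σ l`. -/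
theorem IsIrrepDecomposition.averaging_mem (hdec : IsIrrepDecomposition ω σ n) (F : G → Op d) :
    averaging ω F ∈ ⨆ l, ⨆ u, LinearMap.range (coeffMap d (σ l) u) := by
  classical
  obtain ⟨e, he⟩ := hdec.equiv
  set X : Op d := ∑ k, ((1 / (Fintype.card G : ℝ) : ℝ) : ℂ) • ω k⁻¹ (F k) with hX
  have hF : averaging ω F = fun h => ω h X := funext fun h => averaging_apply ω F h
  have hexp : averaging ω F = ∑ l, ∑ u, coeffMap d (σ l) u
      (∑ j, ∑ i, (Pi.single i (e X l j u) : Fin (D l) → ℂ) ⊗ₜ[ℂ]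
        e.symm (Pi.single l (Pi.single j (Pi.single i 1)))) := by
    rw [hF]
    funext h
    simp only [Finset.sum_apply, map_sum, coeffMap_tmul]
    apply e.injective
    simp only [map_sum, map_smul, e.apply_symm_apply]
    funext l j i
    rw [he]
    simp only [Finset.sum_apply, Pi.smul_apply]
    rw [Finset.sum_eq_single l]
    · simp only [Pi.single_eq_same]
      have hu : ∀ u, ∑ j', ∑ i', Matrix.vecMul (Pi.single i' (e X l j' u) : Fin (D l) → ℂ)
          (σ l h : Matrix _ _ ℂ) u •
            (Pi.single j' (Pi.single i' 1) : Fin (n l) → Fin (D l) → ℂ) j i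
          = (σ l h : Matrix (Fin (D l)) (Fin (D l)) ℂ) i u * e X l j u := by
        intro u
        rw [Finset.sum_eq_single j]
        · rw [Finset.sum_eq_single i]
          · simp [mul_comm]
          · intro i' _ hi; simp [Pi.single_eq_of_ne hi.symm]
          · simp
        · intro j' _ hj
          simp [Pi.single_eq_of_ne hj.symm]
        · simp
      simp only [hu]
      rfl
    · intro l' _ hl
      simp [Pi.single_eq_of_ne hl.symm]
    · simp
  rw [hexp]
  exact Submodule.sum_mem _ fun l _ => Submodule.sum_mem _ fun u _ =>
    Submodule.mem_iSup_of_mem l (Submodule.mem_iSup_of_mem u ⟨_, rfl⟩)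

end Multiplicity

/-! ### Signals of dominant blocks -/

/-- Every linear functional of an orbit in an invariant subspace with matrix `M` is of the form
`k ↦ tr (A M ^ k)`. -/
theorem exists_trace_mul_pow {V : Type*} [AddCommGroup V] [Module ℂ V] {n : ℕ}
    {T : Module.End ℂ V} {b : Fin n → V} {M : Matrix (Fin n) (Fin n) ℂ}
    (hb : ∀ j, T (b j) = ∑ i, M i j • b i) (f : V →ₗ[ℂ] ℂ) {z : V}
    (hz : z ∈ Submodule.span ℂ (Set.range b)) :
    ∃ A : Matrix (Fin n) (Fin n) ℂ, ∀ k : ℕ, f ((T ^ k) z) = (A * M ^ k).trace := by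
  have hpow : ∀ (k : ℕ) j, (T ^ k) (b j) = ∑ i, (M ^ k) i j • b i := by
    intro k
    induction k with
    | zero => intro j; simp [Matrix.one_apply, ite_smul]
    | succ k ih =>
      intro j
      rw [pow_succ, Module.End.mul_apply, hb, map_sum, pow_succ]
      simp only [map_smul, ih, Finset.smul_sum, Matrix.mul_apply, Finset.sum_smul, smul_smul]
      rw [Finset.sum_comm]
      exact Finset.sum_congr rfl fun i _ => Finset.sum_congr rfl fun l _ => by rw [mul_comm]
  obtain ⟨c, rfl⟩ := (Submodule.mem_span_range_iff_exists_fun ℂ).1 hz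
  refine ⟨Matrix.vecMulVec c fun i => f (b i), fun k => ?_⟩
  simp only [map_sum, map_smul, hpow, Matrix.trace, Matrix.diag_apply, Matrix.mul_apply,
    Matrix.vecMulVec_apply, smul_eq_mul, Finset.mul_sum]
  exact Finset.sum_congr rfl fun i _ => Finset.sum_congr rfl fun j _ => by ring

section Main

variable {G : Type*} [Group G] [Fintype G] {d : ℕ} {ω : Representation ℂ G (Op d)}
  {Λ : Type*} [Fintype Λ] {D : Λ → ℕ} {σ : ∀ l, G →* Matrix.unitaryGroup (Fin (D l)) ℂ}
  {n : Λ → ℕ} {φ : G → SuperOp d} {ν : G → ℝ}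

/-- Each Fourier mode inherits the perturbation estimate from the convolution operator. -/
theorem dominantSubspace_fourierSum (hdec : IsIrrepDecomposition ω σ n)
    (hω : ∀ g X, traceNorm (ω g X) ≤ traceNorm X) (hφ : ∀ g X, traceNorm (φ g X) ≤ traceNorm X)
    (hν : IsProbDist ν) {m : ℕ} {x : ℝ} (hx : 0 < x) (hx9 : x ≤ 1 / 9)
    (hT : ∀ F, l1Seminorm G d ((convOp (scaled ν φ) ^ m) F - averaging ω F)
      ≤ x * l1Seminorm G d F) {r : ℝ} (hr : 0 ≤ r) (hrm : r ^ m = 2 / 3) (l : Λ) :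
    IsCompl (dominantSubspace (fourierSum (σ l) (scaled ν φ)) r)
        (slowSubmodule (coeffSeminorm d (σ l)) (fourierSum (σ l) (scaled ν φ) ^ m)) ∧
      Module.finrank ℂ (dominantSubspace (fourierSum (σ l) (scaled ν φ)) r) = n l := by
  have hN := fun z => eq_zero_of_coeffSeminorm_eq_zero (d := d) (σ l) (z := z)
  obtain ⟨Z, h1, h2, h3, h4, h5, -⟩ := exists_dominant_projection (coeffSeminorm d (σ l)) hN
    (fourierAveraging_mul_self (σ l) ω)
    (fun z => by
      simpa using coeffSeminorm_le_of_l1Seminorm_le (σ l) (S := averaging ω) (C := 1)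
        (fun F => by simpa using l1Seminorm_averaging_le hω F)
        (fun u => coeffMap_fourierAveraging (σ l) ω u z))
    hx hx9 (A := fourierSum (σ l) (scaled ν φ) ^ m)
    (fun z => coeffSeminorm_le_of_l1Seminorm_le (σ l)
      (S := convOp (scaled ν φ) ^ m - averaging ω) hT
      (fun u => by
        rw [map_sub, coeffMap_fourierSum_pow, coeffMap_fourierAveraging]
        rfl))
  have hcompl := isCompl_dominantSubspace_slowSubmodule hN
    (T := fourierSum (σ l) (scaled ν φ)) (fun z => by
      simpa using coeffSeminorm_le_of_l1Seminorm_le (σ l) (C := 1)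
        (fun F => by simpa using hν.l1Seminorm_convOp_le hφ F)
        (fun u => coeffMap_fourierSum (σ l) (scaled ν φ) u z)) hr hrm h3 h4 h5
  refine ⟨hcompl, ?_⟩
  rw [← h3] at hcompl
  rw [finrank_eq_finrank_range h1 h2 hcompl, hdec.finrank_range_fourierAveraging]

theorem coeffMap_mem_slowSubmodule {k : ℕ} (σ : G →* Matrix.unitaryGroup (Fin k) ℂ)
    (ψ : G → SuperOp d) (m : ℕ) (u : Fin k) {z : (Fin k → ℂ) ⊗[ℂ] Op d}
    (hz : z ∈ slowSubmodule (coeffSeminorm d σ) (fourierSum σ ψ ^ m)) :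
    coeffMap d σ u z ∈ slowSubmodule (l1Seminorm G d) (convOp ψ ^ m) := by
  obtain ⟨C, hC⟩ := hz
  refine ⟨C, fun j => ?_⟩
  rw [← pow_mul, ← coeffMap_fourierSum_pow, pow_mul]
  exact (l1Seminorm_coeffMap_le σ u _).trans (hC j)

end Main

end RB

theorem theorem3 {G : Type*} [Group G] [Fintype G] {d : ℕ}
    -- the reference representation, by quantum channels, and its decomposition
    (ω : Representation ℂ G (RB.Op d)) (hω : ∀ g, RB.IsQuantumChannel (ω g))
    {Λ : Type*} [Fintype Λ] (D : Λ → ℕ)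
    (σ : ∀ l, G →* Matrix.unitaryGroup (Fin (D l)) ℂ) (n : Λ → ℕ)
    (hdec : RB.IsIrrepDecomposition ω σ n)
    -- the implementation map
    (φ : G → RB.SuperOp d) (hφ : ∀ g, RB.IsCompletelyPositive (φ g))
    (hφ' : ∀ g, RB.IsTraceNonincreasing (φ g))
    -- the sampling distribution
    (ν : G → ℝ) (hν : RB.IsProbDist ν)
    (mMix : ℕ) (hmMix : 0 < mMix) (δ δ' : ℝ) (hδ : 0 < δ) (hδ' : 0 < δ')
    (hmix : ∑ g, |RB.convPow ν mMix g - 1 / (Fintype.card G : ℝ)| ≤ δ')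
    (hclose : ∑ g, ν g * RB.diamondNorm (ω g - φ g) ≤ δ / mMix)
    (hsum : δ + δ' ≤ 1 / 9) :
    -- each Fourier mode has exactly one dominant invariant subspace of dimension `n l`
    (∀ l, ∃! V : Submodule ℂ (TensorProduct ℂ (Fin (D l) → ℂ) (RB.Op d)),
      RB.IsDominantInvariantSubspace (RB.fourier (RB.weighted ν φ) (σ l)) V ∧
        Module.finrank ℂ V = n l) ∧
    -- the restrictions `M l` to these subspaces, in any bases, describe the output data
    (∀ M : ∀ l, Matrix (Fin (n l)) (Fin (n l)) ℂ,
      (∀ l, RB.IsDominantBlock (RB.fourier (RB.weighted ν φ) (σ l)) (M l)) →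
      ∀ (gEnd : G) (prep meas : RB.SuperOp d), RB.IsQuantumChannel prep →
      RB.IsQuantumChannel meas → ∀ ρ₀ : RB.Op d, RB.IsState ρ₀ →
      ∀ (I : Type*) [Fintype I] (E : I → RB.Op d), RB.IsPOVM E → ∀ i : I,
      ∃ A : ∀ l, Matrix (Fin (n l)) (Fin (n l)) ℂ, ∀ m : ℕ, mMix ≤ m →
        ‖RB.outputProb ν φ gEnd prep meas ρ₀ (E i) m
            - ∑ l, (A l * M l ^ (m - mMix)).trace‖ ≤ RB.errorBound (δ + δ')) ∧
    RB.errorBound (δ + δ') ≤ 4 * (δ + δ') := by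
  classical
  have hx : 0 < δ + δ' := add_pos hδ hδ'
  have hωc : ∀ g X, RB.traceNorm (ω g X) ≤ RB.traceNorm X := fun g => (hω g).traceNorm_map_le
  have hφc : ∀ g X, RB.traceNorm (φ g X) ≤ RB.traceNorm X :=
    fun g => RB.traceNorm_map_le (hφ g) (hφ' g)
  have hT := RB.l1Seminorm_convOp_pow_sub_averaging_le hωc hφc hν hmMix hmix hclose
  set r : ℝ := (2 / 3 : ℝ) ^ ((mMix : ℝ)⁻¹) with hr
  have hr0 : 0 ≤ r := by positivity
  have hrm : r ^ mMix = 2 / 3 := Real.rpow_inv_natCast_pow (by norm_num) hmMix.ne'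
  have hdom := RB.dominantSubspace_fourierSum hdec hωc hφc hν hx hsum hT hr0 hrm
  have hisdom : ∀ l, RB.IsDominantInvariantSubspace (RB.fourierSum (σ l) (RB.scaled ν φ))
      (RB.dominantSubspace (RB.fourierSum (σ l) (RB.scaled ν φ)) r) := fun l => ⟨r, rfl⟩
  refine ⟨fun l => ?_, ?_, RB.errorBound_le hx hsum⟩
  · rw [RB.fourier_weighted]
    exact ⟨_, ⟨hisdom l, (hdom l).2⟩, fun V hV =>
      hV.1.eq_of_finrank_eq (hisdom l) (hV.2.trans (hdom l).2.symm)⟩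
  intro M hM gEnd prep meas hprep hmeas ρ₀ hρ₀ I _ E hE i
  set T := RB.convOp (RB.scaled ν φ) with hTdef
  have hTc : ∀ F, RB.l1Seminorm G d (T F) ≤ RB.l1Seminorm G d F := hν.l1Seminorm_convOp_le hφc
  obtain ⟨Z, h1, h2, hker, -, -, happrox⟩ := RB.exists_dominant_projection (RB.l1Seminorm G d)
    (fun F => RB.eq_zero_of_l1Seminorm_eq_zero) (RB.averaging_mul_self ω)
    (RB.l1Seminorm_averaging_le hωc) hx hsum hT
  set f : (G → RB.Op d) →ₗ[ℂ] ℂ :=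
    RB.readout φ gEnd meas (E i) ∘ₗ RB.averaging ω ∘ₗ (T ^ mMix) ∘ₗ Z with hf
  -- The initial conditions whose signal under `f` is a combination of powers of the `M l`.
  let S : Submodule ℂ (G → RB.Op d) :=
    { carrier := {F | ∃ A : ∀ l, Matrix (Fin (n l)) (Fin (n l)) ℂ,
        ∀ k : ℕ, f ((T ^ k) F) = ∑ l, (A l * M l ^ k).trace}
      zero_mem' := ⟨0, fun k => by simp⟩
      add_mem' := by
        rintro F F' ⟨A, hA⟩ ⟨A', hA'⟩
        refine ⟨A + A', fun k => ?_⟩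
        simp only [map_add, hA, hA', Pi.add_apply, Matrix.add_mul, Matrix.trace_add,
          Finset.sum_add_distrib]
      smul_mem' := by
        rintro c F ⟨A, hA⟩
        refine ⟨c • A, fun k => ?_⟩
        simp only [map_smul, hA, Pi.smul_apply, Matrix.smul_mul, Matrix.trace_smul,
          Finset.smul_sum] }
  have hslow : RB.slowSubmodule (RB.l1Seminorm G d) (T ^ mMix) ≤ S := by
    intro F hF
    have hk : ∀ k : ℕ, (T ^ k) F ∈ RB.slowSubmodule (RB.l1Seminorm G d) (T ^ mMix) := by
      intro k
      induction k with
      | zero => exact hF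
      | succ k ih =>
        rw [pow_succ', Module.End.mul_apply]
        exact RB.map_mem_slowSubmodule (Commute.self_pow T mMix) (C₀ := 1)
          (by simpa using hTc) ih
    refine ⟨0, fun k => ?_⟩
    have : Z ((T ^ k) F) = 0 := by rw [← LinearMap.mem_ker, hker]; exact hk k
    simp [hf, this]
  have hcoeff : ∀ l u, LinearMap.range (RB.coeffMap d (σ l) u) ≤ S := by
    rintro l u _ ⟨z, rfl⟩
    obtain ⟨z₁, hz₁, z₂, hz₂, rfl⟩ := Submodule.mem_sup.1
      ((hdom l).1.sup_eq_top ▸ Submodule.mem_top : z ∈ _ ⊔ _)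
    rw [map_add]
    refine S.add_mem ?_ (hslow (RB.coeffMap_mem_slowSubmodule (σ l) _ mMix u hz₂))
    obtain ⟨b, hli, hbdom, hb⟩ := hM l
    rw [RB.fourier_weighted] at hbdom hb
    have hspan := hbdom.eq_of_finrank_eq (hisdom l)
      (by rw [(hdom l).2, finrank_span_eq_card hli, Fintype.card_fin])
    obtain ⟨A, hA⟩ := RB.exists_trace_mul_pow hb (f ∘ₗ RB.coeffMap d (σ l) u) (hspan ▸ hz₁)
    refine ⟨Pi.single l A, fun k => ?_⟩
    rw [← RB.coeffMap_fourierSum_pow, Finset.sum_eq_single l, Pi.single_eq_same, ← hA]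
    · rfl
    · intro l' _ hl
      rw [Pi.single_eq_of_ne hl, Matrix.zero_mul, Matrix.trace_zero]
    · simp
  set F₀ : G → RB.Op d := Pi.single 1 (prep ρ₀) with hF₀
  have hF₀S : F₀ ∈ S := by
    rw [← sub_add_cancel F₀ (Z F₀)]
    refine S.add_mem (hslow ?_) ?_
    · have hZZ : Z (Z F₀) = Z F₀ := by
        rw [← Module.End.mul_apply]
        nth_rw 2 [← h2]
        rw [← mul_assoc, h1, h2]
      rw [← hker, LinearMap.mem_ker, map_sub, hZZ, sub_self]
    · rw [← h2, Module.End.mul_apply]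
      exact (iSup_le fun l => iSup_le fun u => hcoeff l u) (hdec.averaging_mem (Z F₀))
  obtain ⟨A, hA⟩ := hF₀S
  refine ⟨A, fun m hm => ?_⟩
  obtain ⟨k, rfl⟩ := Nat.exists_eq_add_of_le hm
  rw [Nat.add_sub_cancel_left, ← hA, RB.outputProb_eq_readout, pow_add, Module.End.mul_apply]
  have hnorm : ∀ k : ℕ, RB.l1Seminorm G d ((T ^ k) F₀) ≤ 1 := by
    intro k
    induction k with
    | zero =>
      rw [pow_zero, Module.End.one_apply, RB.l1Seminorm_apply, Finset.sum_eq_single 1]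
      · rw [hF₀, Pi.single_eq_same]
        have := RB.traceNorm_le_trace hρ₀.posSemidef
        rw [hρ₀.trace_eq_one, Complex.one_re] at this
        exact (hprep.traceNorm_map_le ρ₀).trans this
      · intro h _ hh
        rw [hF₀, Pi.single_eq_of_ne hh]
        exact map_zero (RB.traceSeminorm (Fin d))
      · simp
    | succ k ih =>
      rw [pow_succ', Module.End.mul_apply]
      exact (hTc _).trans ih
  have hbound0 := RB.errorBound_nonneg hx hsum
  calc _ = ‖RB.readout φ gEnd meas (E i) ((T ^ mMix) ((T ^ k) F₀)
          - RB.averaging ω ((T ^ mMix) (Z ((T ^ k) F₀))))‖ := by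
        rw [map_sub]; rfl
    _ ≤ _ := RB.norm_readout_le hφc gEnd hmeas.traceNorm_map_le (hE.posSemidef i)
        (hE.posSemidef_one_sub i) _
    _ ≤ RB.errorBound (δ + δ') * RB.l1Seminorm G d ((T ^ k) F₀) := happrox _
    _ ≤ RB.errorBound (δ + δ') := mul_le_of_le_one_right hbound0 (hnorm k)
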